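/- Let $X,Y,Z$ be the Pauli matrices, let $\mathcal F_1=\{Z\otimes X,\,X,\,Z,\,(X-Y)/\sqrt2\}$ and $\mathcal F_2=\{Z\otimes X,\,Z,\,(X-Y)/\sqrt2\}$. For a family $\mathcal F$ of observables, each of them a Hermitian matrix with square $I$ acting on a fixed number of qubits, a *conditional composition of measurements from $\mathcal F$* on a register of $n+k$ qubits ($n$ logical and $k$ ancillary ones) is a finite decision tree: at each inner node an observable of $\mathcal F$ is projectively measured on some distinct qubits of the register, chosen depending on the earlier outcomes, and each leaf announces either failure, or success together with the physical locations of the $n$ logical output qubits. It *simulates* a unitary $V$ on $n$ qubits *with probability greater than $1-\varepsilon$* if, for every state $|\varphi\rangle$ of the logical qubits and every initial state $|\chi\rangle$ of the ancillary qubits, success is announced with probability greater than $1-\varepsilon$, and whenever it is announced, the final state is $V|\varphi\rangle$ (up to a global phase) on the announced qubits, in product with some state of the other $k$ qubits. The family $\mathcal F$ is *approximately universal using $k$ ancillary qubits* if for every $n$, every unitary $U$ on $n$ qubits, every $\varepsilon>0$ and every $\delta>0$, there is a unitary $V$ with $\|U-V\|<\delta$ (operator norm) and a conditional composition of measurements from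 $\mathcal F$ on $n+k$ qubits that simulates $V$ with probability greater than $1-\varepsilon$. **Theorem.** $\mathcal F_2$ is approximately universal using only one ancillary qubit. Consequently there is no trade-off between observables and ancillary qubits of the kind in which dropping the observable $X$ from $\mathcal F_1$ costs an additional ancillary qubit: $\mathcal F_2\subsetneq\mathcal F_1$, and for both families the least number of ancillary qubits for which the family is approximately universal is one. -/

import Mathlib

namespace MBQC

/-- The state space of a register of qubits indexed by `Q`: the Hilbert space with orthonormal
basis the bit assignments `Q → Fin 2`, that is `(ℂ²)^{⊗ Q}`. -/
abbrev State (Q : Type) : Type := EuclideanSpace ℂ (Q → Fin 2)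

/-- Matrices of operators on a register of qubits, in the computational basis. -/
abbrev Op (Q : Type) : Type := Matrix (Q → Fin 2) (Q → Fin 2) ℂ

section Observables

/-- A `±1`-valued observable on `arity` qubits: a Hermitian matrix whose square is `1`. -/
structure Observable where
  arity : ℕ
  mat : Op (Fin arity)
  hermitian : mat.IsHermitian
  involutive : mat * mat = 1

/-- The tensor product `A 0 ⊗ ⋯ ⊗ A (m - 1)` of one-qubit operators. -/
def tensor {m : ℕ} (A : Fin m → Matrix (Fin 2) (Fin 2) ℂ) : Op (Fin m) :=
  Matrix.of fun x y => ∏ i, A i (x i) (y i)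

theorem tensor_hermitian {m : ℕ} (A : Fin m → Matrix (Fin 2) (Fin 2) ℂ)
    (hA : ∀ i, (A i).IsHermitian) : (tensor A).IsHermitian := by
  ext x y
  simp only [tensor, Matrix.conjTranspose_apply, Matrix.of_apply, star_prod]
  exact Finset.prod_congr rfl fun i _ => (hA i).apply (x i) (y i)

theorem tensor_involutive {m : ℕ} (A : Fin m → Matrix (Fin 2) (Fin 2) ℂ)
    (hA : ∀ i, A i * A i = 1) : tensor A * tensor A = 1 := by
  ext x z
  have h : ∀ i, ∑ b, A i (x i) b * A i b (z i) = (1 : Matrix (Fin 2) (Fin 2) ℂ) (x i) (z i) := by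
    intro i
    rw [← hA i, Matrix.mul_apply]
  simp only [tensor, Matrix.mul_apply, Matrix.of_apply, ← Finset.prod_mul_distrib]
  rw [← Fintype.prod_sum (fun i b => A i (x i) b * A i b (z i))]
  simp only [h, Matrix.one_apply]
  by_cases hxz : x = z
  · subst hxz
    simp
  · obtain ⟨i, hi⟩ := Function.ne_iff.mp hxz
    rw [if_neg hxz]
    exact Finset.prod_eq_zero (Finset.mem_univ i) (if_neg hi)

/-- The observable `A 0 ⊗ ⋯ ⊗ A (m - 1)`. -/
def Observable.ofTensor {m : ℕ} (A : Fin m → Matrix (Fin 2) (Fin 2) ℂ)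
    (hA : ∀ i, (A i).IsHermitian) (hA' : ∀ i, A i * A i = 1) : Observable where
  arity := m
  mat := tensor A
  hermitian := tensor_hermitian A hA
  involutive := tensor_involutive A hA'

/-- The Pauli matrix `X`. -/
def pauliX : Matrix (Fin 2) (Fin 2) ℂ := !![0, 1; 1, 0]

/-- The Pauli matrix `Y`. -/
def pauliY : Matrix (Fin 2) (Fin 2) ℂ := !![0, -Complex.I; Complex.I, 0]

/-- The Pauli matrix `Z`. -/
def pauliZ : Matrix (Fin 2) (Fin 2) ℂ := !![1, 0; 0, -1]

/-- The matrix `(X - Y) / √2`. -/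
noncomputable def matXY : Matrix (Fin 2) (Fin 2) ℂ :=
  ((Real.sqrt 2 : ℝ) : ℂ)⁻¹ • (pauliX - pauliY)

theorem pauliX_hermitian : pauliX.IsHermitian := by
  ext i j
  fin_cases i <;> fin_cases j <;> simp [pauliX]

theorem pauliZ_hermitian : pauliZ.IsHermitian := by
  ext i j
  fin_cases i <;> fin_cases j <;> simp [pauliZ]

theorem matXY_hermitian : matXY.IsHermitian := by
  ext i j
  fin_cases i <;> fin_cases j <;> simp [matXY, pauliX, pauliY] <;> ring

theorem pauliX_sq : pauliX * pauliX = 1 := by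
  ext i j
  fin_cases i <;> fin_cases j <;> simp [pauliX]

theorem pauliZ_sq : pauliZ * pauliZ = 1 := by
  ext i j
  fin_cases i <;> fin_cases j <;> simp [pauliZ]

theorem matXY_sq : matXY * matXY = 1 := by
  have h2 : (((Real.sqrt 2 : ℝ) : ℂ)⁻¹ * ((Real.sqrt 2 : ℝ) : ℂ)⁻¹) = 2⁻¹ := by
    rw [← mul_inv, ← Complex.ofReal_mul, Real.mul_self_sqrt (by norm_num)]
    norm_num
  have h : (pauliX - pauliY) * (pauliX - pauliY) = (2 : ℂ) • (1 : Matrix (Fin 2) (Fin 2) ℂ) := by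
    ext i j
    fin_cases i <;> fin_cases j <;>
      simp [pauliX, pauliY, Matrix.mul_apply] <;> ring_nf <;> (simp; norm_num)
  rw [matXY, Matrix.smul_mul, Matrix.mul_smul, smul_smul, h2, h, smul_smul]
  norm_num

/-- The one-qubit observable `X`. -/
def obsX : Observable :=
  Observable.ofTensor ![pauliX] (by simp [pauliX_hermitian]) (by simp [pauliX_sq])

/-- The one-qubit observable `Z`. -/
def obsZ : Observable :=
  Observable.ofTensor ![pauliZ] (by simp [pauliZ_hermitian]) (by simp [pauliZ_sq])

/-- The one-qubit observable `(X - Y) / √2`. -/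
noncomputable def obsXY : Observable :=
  Observable.ofTensor ![matXY] (by simp [matXY_hermitian]) (by simp [matXY_sq])

/-- The two-qubit observable `Z ⊗ X`. -/
def obsZX : Observable :=
  Observable.ofTensor ![pauliZ, pauliX]
    (by simp [Fin.forall_fin_two, pauliZ_hermitian, pauliX_hermitian])
    (by simp [Fin.forall_fin_two, pauliZ_sq, pauliX_sq])

/-- The four-element family `{Z ⊗ X, X, Z, (X - Y) / √2}`. -/
noncomputable def F1 : Set Observable := {obsZX, obsX, obsZ, obsXY}

/-- The three-element family `{Z ⊗ X, Z, (X - Y) / √2}`. -/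
noncomputable def F2 : Set Observable := {obsZX, obsZ, obsXY}

end Observables

section Measurements

variable {Q : Type} [Fintype Q] [DecidableEq Q]

open Classical in
/-- The operator on the whole register `Q` that acts as `A` on the distinct qubits
`e 0, …, e (m - 1)`, in this order, and as the identity on the others. -/
noncomputable def actOn {m : ℕ} (A : Op (Fin m)) (e : Fin m ↪ Q) : Op Q :=
  Matrix.of fun x y =>
    if ∀ q, q ∉ Set.range e → x q = y q then A (fun i => x (e i)) (fun i => y (e i)) else 0

/-- The spectral projector of the observable `A`, measured on the qubits `e`, for the outcome
`+1` (`true`) or `-1` (`false`); since `A² = 1`, it is `(1 ± A) / 2`. -/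
noncomputable def projector (A : Observable) (e : Fin A.arity ↪ Q) (b : Bool) : Op Q :=
  (2 : ℂ)⁻¹ • (1 + (if b then (1 : ℂ) else -1) • actOn A.mat e)

/-- The unnormalized state after outcome `b`; its squared norm is the probability of `b`
(times the squared norm of `ψ`). -/
noncomputable def collapse (A : Observable) (e : Fin A.arity ↪ Q) (b : Bool) (ψ : State Q) :
    State Q :=
  Matrix.toEuclideanLin (projector A e b) ψ

/-- A conditional composition of projective measurements of observables of the family `F` on the
register `Q`: a finite decision tree. Each inner node measures an observable of `F` on some distinct
qubits of the register and continues according to the outcome. A leaf announces either failure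
(`none`) or success; in the latter case it gives a permutation which says at which physical qubits
the result is located. -/
inductive Protocol (F : Set Observable) (Q : Type) : Type
  | done (r : Option (Equiv.Perm Q)) : Protocol F Q
  | measure (A : Observable) (hA : A ∈ F) (e : Fin A.arity ↪ Q) (next : Bool → Protocol F Q) :
      Protocol F Q

/-- The probability that the protocol, run on the state `ψ`, announces success. (On an unnormalized
state, the probability is multiplied by the squared norm of the state.) -/
noncomputable def Protocol.successProb {F : Set Observable} : Protocol F Q → State Q → ℝ
  | .done none, _ => 0
  | .done (some _), ψ => ‖ψ‖ ^ 2
  | .measure A _ e next, ψ =>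
      (next true).successProb (collapse A e true ψ) +
        (next false).successProb (collapse A e false ψ)

/-- Whenever the protocol, run on `ψ`, announces success with the locations `π`, the final
(unnormalized) state satisfies `G π`. -/
def Protocol.OnSuccess {F : Set Observable} (G : Equiv.Perm Q → State Q → Prop) :
    Protocol F Q → State Q → Prop
  | .done none, _ => True
  | .done (some π), ψ => G π ψ
  | .measure A _ e next, ψ =>
      (next true).OnSuccess G (collapse A e true ψ) ∧
        (next false).OnSuccess G (collapse A e false ψ)

end Measurements

section Universality

variable {n k : ℕ}

/-- The product state `φ ⊗ χ` of `n` logical and `k` ancillary qubits in a register of `n + k`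
physical qubits, in which the `i`-th logical qubit is located at the physical qubit `π (inl i)` and
the `j`-th ancillary qubit at `π (inr j)`. -/
noncomputable def place (π : Equiv.Perm (Fin n ⊕ Fin k)) (φ : State (Fin n)) (χ : State (Fin k)) :
    State (Fin n ⊕ Fin k) :=
  WithLp.toLp 2 fun x => φ (fun i => x (π (Sum.inl i))) * χ (fun j => x (π (Sum.inr j)))

/-- The protocol simulates `V` with probability greater than `1 - ε`: for every state `φ` of the `n`
logical qubits and every initial state `χ` of the `k` ancillary qubits, it announces success with
probability greater than `1 - ε`, and then the final state is `V φ` at the announced locations, in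
product with some (unnormalized) state `χ'` of the remaining qubits. A global phase is absorbed in
`χ'`. -/
def Protocol.Simulates {F : Set Observable} (p : Protocol F (Fin n ⊕ Fin k)) (V : Op (Fin n))
    (ε : ℝ) : Prop :=
  ∀ (φ : State (Fin n)) (χ : State (Fin k)), ‖φ‖ = 1 → ‖χ‖ = 1 →
    1 - ε < p.successProb (place 1 φ χ) ∧
    p.OnSuccess (fun π ψ => ∃ χ' : State (Fin k), ψ = place π (Matrix.toEuclideanLin V φ) χ')
      (place 1 φ χ)

/-- The family `F` of observables is approximately universal using `k` ancillary qubits: for every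
number `n` of qubits, every unitary `U` on `n` qubits and all `ε, δ > 0`, some conditional
composition of projective measurements from `F` on `n + k` qubits simulates, with probability
greater than `1 - ε`, a unitary `V` with `‖U - V‖ < δ` in operator norm. -/
def ApproxUniversal (F : Set Observable) (k : ℕ) : Prop :=
  ∀ (n : ℕ) (U : Op (Fin n)), U ∈ Matrix.unitaryGroup (Fin n → Fin 2) ℂ →
    ∀ ε : ℝ, 0 < ε → ∀ δ : ℝ, 0 < δ →
      ∃ V : Op (Fin n), V ∈ Matrix.unitaryGroup (Fin n → Fin 2) ℂ ∧
        ‖Matrix.toEuclideanCLM (n := Fin n → Fin 2) (𝕜 := ℂ) (U - V)‖ < δ ∧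
        ∃ p : Protocol F (Fin n ⊕ Fin k), p.Simulates V ε

end Universality

end MBQC

/-! The single ancilla serves for state transfers. Measuring Z on the ancilla, Z ⊗ X on a logical
qubit and the ancilla, and (X - Y)/√2 on the logical qubit moves that qubit to the site of the
ancilla and applies HT up to random Pauli factors; the old site becomes the new ancilla. Measuring
(X - Y)/√2 on the ancilla, Z ⊗ X on the ancilla and the logical qubit, and Z on the logical qubit
does the same with (HT)†. A transfer with two Z ⊗ X measurements, the first controlled by another
logical qubit, gives a controlled Z times a Hadamard gate, again up to Paulis.

The observable X is not needed, because Pauli factors can be removed by a random walk. An inverse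
transfer followed by a forward one amounts to a Pauli, and whatever the states, the forward transfer
produces each of the four Paulis with probability 1/4. So each round hits the wanted Pauli with
probability 1/4, and otherwise another Pauli remains to be corrected; m rounds fail with probability
(3/4)^m (`simulableAt_mul_pauli`). Hence Paulis, HT and CZ·H can precede any simulable operator.

These gates are dense in the unitary group (`eq_top_of_gates`). In the closed group S that they
generate, consider the Hermitian a with exp(ita) ∈ S for all real t. By the Lie product formula they
form a real vector space, stable under conjugation by S. Conjugating X three times by HT gives an
involution M for which MZ rotates by an angle θ with 2 cos θ = 1 - 1/√2. This is not an algebraic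
integer, so θ/2π is irrational and the powers of MZ fill a one-parameter group. From it come all
one-qubit Paulis, by conjugation with CZ all Pauli strings, and by linearity all Hermitian matrices.

One ancilla is also necessary (`not_approxUniversal_F1_zero`): without it a measurement of a
nontrivial observable destroys information about the logical state, while a tree without
measurements can only relabel qubits. -/

namespace MBQC

/-! ### One-parameter groups inside a closed group of unitaries -/

section OneParameter

open NormedSpace Filter Topology

variable {A : Type*} [CStarAlgebra A]

/-- The self-adjoint elements `a` whose one-parameter group `t ↦ exp (i t a)` lies in `S`. -/
def IsGenerator (S : Subgroup (unitary A)) (a : A) : Prop :=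
  IsSelfAdjoint a ∧ ∀ t : ℝ, ∃ u ∈ S, (u : A) = exp (((t : ℂ) * Complex.I) • a)

theorem exp_smul_add (a : A) (z w : ℂ) : exp ((z + w) • a) = exp (z • a) * exp (w • a) := by
  let +nondep : NormedAlgebra ℚ A := .restrictScalars ℚ ℂ A
  rw [add_smul]
  exact exp_add_of_commute (((Commute.refl a).smul_left z).smul_right w)

theorem exp_nsmul_smul (a : A) (z : ℂ) (m : ℕ) : exp ((m * z) • a) = exp (z • a) ^ m := by
  induction m with
  | zero => simp
  | succ m ih => rw [Nat.cast_succ, add_mul, one_mul, exp_smul_add, ih, pow_succ]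

theorem exp_mem_unitary {a : A} (ha : IsSelfAdjoint a) (t : ℝ) :
    exp (((t : ℂ) * Complex.I) • a) ∈ unitary A := by
  let +nondep : NormedAlgebra ℚ A := .restrictScalars ℚ ℂ A
  apply exp_mem_unitary_of_mem_skewAdjoint
  rw [skewAdjoint.mem_iff, star_smul, ha.star_eq]
  simp

/-- The one-parameter group of an involution. -/
theorem exp_involution {a : A} (ha : a * a = 1) (t : ℝ) :
    exp (((t : ℂ) * Complex.I) • a)
      = (Real.cos t : ℂ) • (1 : A) + ((Real.sin t : ℂ) * Complex.I) • a := by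
  set z : ℂ := (t : ℂ) * Complex.I with hz
  -- Spectral decomposition: (1 ± a)/2 are the projections onto the eigenvalues ±1, so the
  -- exponential series splits into two scalar series.
  have hpow : ∀ k : ℕ, a ^ k = (2⁻¹ : ℂ) • (1 + a) + ((-1) ^ k * 2⁻¹ : ℂ) • (1 - a) := by
    intro k
    induction k with
    | zero => rw [pow_zero, pow_zero, one_mul, ← smul_add]; simp [← two_smul ℂ (1 : A), smul_smul]
    | succ k ih =>
      rw [pow_succ, ih]
      simp only [add_mul, smul_mul_assoc, sub_mul, one_mul, ha]
      rw [add_comm a 1, ← neg_sub (1 : A) a, smul_neg, ← neg_smul]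
      congr 2
      ring
  have h1 : HasSum (fun k : ℕ => ((k.factorial : ℂ)⁻¹ * z ^ k * 2⁻¹) • (1 + a)
      + ((k.factorial : ℂ)⁻¹ * (-z) ^ k * 2⁻¹) • (1 - a))
      ((exp z * 2⁻¹) • (1 + a) + (exp (-z) * 2⁻¹) • (1 - a)) := by
    have e : ∀ w : ℂ, HasSum (fun k : ℕ => (k.factorial : ℂ)⁻¹ * w ^ k * 2⁻¹) (exp w * 2⁻¹) :=
      fun w => ((exp_series_hasSum_exp' (𝕂 := ℂ) w).mul_right _)
    exact ((e z).smul_const _).add ((e (-z)).smul_const _)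
  have h2 := exp_series_hasSum_exp' (𝕂 := ℂ) (z • a)
  have h3 : (fun k : ℕ => (k.factorial : ℂ)⁻¹ • (z • a) ^ k)
      = fun k : ℕ => ((k.factorial : ℂ)⁻¹ * z ^ k * 2⁻¹) • (1 + a)
      + ((k.factorial : ℂ)⁻¹ * (-z) ^ k * 2⁻¹) • (1 - a) := by
    funext k
    rw [smul_pow, hpow, smul_add, smul_add, smul_smul, smul_smul, smul_smul, smul_smul]
    rw [neg_pow]
    module
  rw [h3] at h2
  rw [h2.unique h1, ← Complex.exp_eq_exp_ℂ, hz, Complex.exp_mul_I, ← neg_mul, Complex.exp_mul_I,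
    Complex.cos_neg, Complex.sin_neg, Complex.ofReal_cos, Complex.ofReal_sin]
  module

/-- Telescoping. The bounds are put as nonexpansive multiplication, the form in which unitaries
satisfy them. -/
theorem pow_sub_pow_le {R : Type*} [SeminormedRing R] {x y : R} (hx : ∀ b : R, ‖x * b‖ ≤ ‖b‖)
    (hy : ∀ b : R, ‖b * y‖ ≤ ‖b‖) (m : ℕ) : ‖x ^ m - y ^ m‖ ≤ m * ‖x - y‖ := by
  induction m with
  | zero => simp
  | succ m ih =>
    have h : x ^ (m + 1) - y ^ (m + 1) = x ^ m * (x - y) + (x ^ m - y ^ m) * y := by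
      rw [pow_succ, pow_succ]; noncomm_ring
    have hx' : ∀ (k : ℕ) (b : R), ‖x ^ k * b‖ ≤ ‖b‖ := by
      intro k
      induction k with
      | zero => simp
      | succ k ihk => intro b; rw [pow_succ', mul_assoc]; exact (hx _).trans (ihk b)
    rw [h]
    refine (norm_add_le _ _).trans ?_
    push_cast
    linarith [hx' m (x - y), (hy (x ^ m - y ^ m)).trans ih]

/-- The Lie product formula for skew-adjoint exponentials. -/
theorem tendsto_exp_mul_exp_pow {a b : A} (ha : IsSelfAdjoint a) (hb : IsSelfAdjoint b) (t : ℝ) :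
    Tendsto (fun m : ℕ => (exp ((((t / (m + 1) : ℝ) : ℂ) * Complex.I) • a)
      * exp ((((t / (m + 1) : ℝ) : ℂ) * Complex.I) • b)) ^ (m + 1)) atTop
      (𝓝 (exp (((t : ℂ) * Complex.I) • (a + b)))) := by
  have hd : ∀ c : A, HasDerivAt (fun s : ℝ => exp (((s : ℂ) * Complex.I) • c))
      (Complex.I • c) 0 := by
    intro c
    have := hasDerivAt_exp_smul_const (𝕂 := ℝ) (Complex.I • c) 0
    simp only [zero_smul, exp_zero, one_mul] at this
    refine this.congr_of_eventuallyEq (Eventually.of_forall fun s => ?_)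
    simp only [← Complex.coe_smul, smul_smul]
  -- The two sides of the product formula agree to first order at s = 0, so at s = t/(m+1) their
  -- difference is o(1/m), which survives the m + 1 telescoped terms.
  have hF : HasDerivAt (fun s : ℝ => exp (((s : ℂ) * Complex.I) • a)
      * exp (((s : ℂ) * Complex.I) • b) - exp (((s : ℂ) * Complex.I) • (a + b))) 0 0 := by
    have := ((hd a).fun_mul (hd b)).fun_sub (hd (a + b))
    simpa using this
  have hlim : Tendsto (fun m : ℕ => ((m : ℝ) + 1) *
      ‖exp ((((t / (m + 1) : ℝ) : ℂ) * Complex.I) • a)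
      * exp ((((t / (m + 1) : ℝ) : ℂ) * Complex.I) • b)
      - exp ((((t / (m + 1) : ℝ) : ℂ) * Complex.I) • (a + b))‖) atTop (𝓝 0) := by
    rcases eq_or_ne t 0 with rfl | ht
    · simp
    have hs : Tendsto (fun m : ℕ => t / ((m : ℝ) + 1)) atTop (𝓝[≠] 0) := by
      rw [tendsto_nhdsWithin_iff]
      refine ⟨?_, Eventually.of_forall fun m => ?_⟩
      · have := (tendsto_one_div_add_atTop_nhds_zero_nat (𝕜 := ℝ)).const_mul t
        simpa only [mul_one_div, mul_zero] using this
      · have : (m : ℝ) + 1 ≠ 0 := by positivity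
        simpa using ⟨ht, this⟩
    have h0 := (hasDerivAt_iff_tendsto_slope.mp hF).comp hs
    have h1 := (h0.norm.const_mul |t|)
    simp only [norm_zero, mul_zero] at h1
    refine h1.congr fun m => ?_
    have hm : (0 : ℝ) < (m : ℝ) + 1 := by positivity
    simp only [Function.comp, slope_def_module, norm_smul, sub_zero, Complex.ofReal_zero, zero_mul,
      zero_smul, exp_zero, mul_one, sub_self, norm_inv, Real.norm_eq_abs, abs_div, abs_of_pos hm]
    have : |t| ≠ 0 := abs_ne_zero.mpr ht
    field_simp
  rw [tendsto_iff_norm_sub_tendsto_zero]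
  refine squeeze_zero (fun _ => norm_nonneg _) (fun m => ?_) hlim
  have hm : ((m : ℝ) + 1) ≠ 0 := by positivity
  have e : ((t : ℂ) * Complex.I)
      = ((m + 1 : ℕ) : ℂ) * (((t / (m + 1) : ℝ) : ℂ) * Complex.I) := by
    rw [← mul_assoc]
    congr 1
    push_cast
    field_simp
  rw [e, exp_nsmul_smul, ← Nat.cast_succ]
  refine pow_sub_pow_le (fun c => ?_) (fun c => ?_) (m + 1)
  · exact (CStarRing.norm_coe_unitary_mul
      (⟨_, exp_mem_unitary ha _⟩ * ⟨_, exp_mem_unitary hb _⟩ : unitary A) c).le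
  · exact (CStarRing.norm_mul_coe_unitary c
      (⟨_, exp_mem_unitary (ha.add hb) _⟩ : unitary A)).le

variable {S : Subgroup (unitary A)}

/-- The approximants in the Lie product formula lie in S, and S is closed. -/
theorem IsGenerator.add (hS : IsClosed (S : Set (unitary A))) {a b : A} (ha : IsGenerator S a)
    (hb : IsGenerator S b) : IsGenerator S (a + b) := by
  refine ⟨ha.1.add hb.1, fun t => ⟨⟨_, exp_mem_unitary (ha.1.add hb.1) t⟩, ?_, rfl⟩⟩
  choose u hu hu' using fun m : ℕ => ha.2 (t / (m + 1))
  choose v hv hv' using fun m : ℕ => hb.2 (t / (m + 1))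
  refine hS.mem_of_tendsto (f := fun m : ℕ => (u m * v m) ^ (m + 1)) (b := atTop) ?_
    (Eventually.of_forall fun m => S.pow_mem (S.mul_mem (hu m) (hv m)) _)
  rw [tendsto_subtype_rng]
  simpa [hu', hv'] using tendsto_exp_mul_exp_pow ha.1 hb.1 t

theorem IsGenerator.smul {a : A} (ha : IsGenerator S a) (r : ℝ) :
    IsGenerator S ((r : ℂ) • a) := by
  refine ⟨?_, fun t => ?_⟩
  · rw [isSelfAdjoint_iff, star_smul, ha.1.star_eq]; simp
  · obtain ⟨u, hu, hu'⟩ := ha.2 (t * r)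
    refine ⟨u, hu, ?_⟩
    rw [hu', smul_smul]
    congr 2
    push_cast
    ring

theorem IsGenerator.zero : IsGenerator S (0 : A) :=
  ⟨.zero A, fun t => ⟨1, S.one_mem, by simp⟩⟩

theorem IsGenerator.sum (hS : IsClosed (S : Set (unitary A))) {ι : Type*} (s : Finset ι)
    (f : ι → A) (hf : ∀ i ∈ s, IsGenerator S (f i)) : IsGenerator S (∑ i ∈ s, f i) := by
  classical
  induction s using Finset.induction_on with
  | empty => simpa using IsGenerator.zero
  | insert i s hi ih =>
    rw [Finset.sum_insert hi]
    exact (hf i (by simp)).add hS (ih fun j hj => hf j (by simp [hj]))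

theorem IsGenerator.conj {a : A} (ha : IsGenerator S a) {u : unitary A} (hu : u ∈ S) :
    IsGenerator S ((u : A) * a * star (u : A)) := by
  refine ⟨ha.1.conjugate (u : A), fun t => ?_⟩
  obtain ⟨v, hv, hv'⟩ := ha.2 t
  refine ⟨u * v * u⁻¹, S.mul_mem (S.mul_mem hu hv) (S.inv_mem hu), ?_⟩
  let +nondep : NormedAlgebra ℚ A := .restrictScalars ℚ ℂ A
  have := exp_units_conj (Unitary.toUnits u) (((t : ℂ) * Complex.I) • a)
  have e : ((u⁻¹ : unitary A) : A) = star (u : A) := rfl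
  simp only [Unitary.val_toUnits_apply, ← map_inv, e] at this
  rw [← smul_mul_assoc, ← mul_smul_comm]
  simp only [Submonoid.coe_mul, hv', e]
  rw [← this]

/-- If an involution generates, then it lies in the group, up to a phase. -/
theorem IsGenerator.smul_I_mem {a : A} (ha : IsGenerator S a) (h1 : a * a = 1) :
    ∃ u ∈ S, (u : A) = Complex.I • a := by
  obtain ⟨u, hu, hu'⟩ := ha.2 (Real.pi / 2)
  refine ⟨u, hu, ?_⟩
  rw [hu', exp_involution h1]
  simp

/-- Anticommuting generators, one of them an involution, are closed under the product. -/
theorem IsGenerator.I_smul_mul {a b : A} (ha : IsGenerator S a) (hb : IsGenerator S b)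
    (h1 : b * b = 1) (hab : a * b = -(b * a)) : IsGenerator S (Complex.I • (b * a)) := by
  -- Conjugating a by (1 + ib)/√2 gives (a + iba - iab + bab)/2, which is iba since ab = -ba.
  obtain ⟨u, hu, hu'⟩ := hb.2 (Real.pi / 4)
  have h := ha.conj hu
  rw [exp_involution h1, Real.cos_pi_div_four, Real.sin_pi_div_four] at hu'
  convert h using 1
  have hs : ((Real.sqrt 2 / 2 : ℝ) : ℂ) * ((Real.sqrt 2 / 2 : ℝ) : ℂ) = 2⁻¹ := by
    rw [← Complex.ofReal_mul, div_mul_div_comm, Real.mul_self_sqrt (by norm_num)]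
    norm_num
  rw [hu', star_add, star_smul, star_smul, star_one, hb.1.star_eq]
  set s : ℂ := ((Real.sqrt 2 / 2 : ℝ) : ℂ)
  have hss : star s = s := Complex.conj_ofReal _
  have hbab : b * a * b = -a := by rw [mul_assoc, hab, mul_neg, ← mul_assoc, h1, one_mul]
  simp only [star_mul', hss, Complex.star_def, Complex.conj_I, add_mul, mul_add, smul_mul_assoc,
    mul_smul_comm, one_mul, mul_one, hbab, hab, smul_neg]
  match_scalars
  · linear_combination (-2 * Complex.I) * hs
  · linear_combination (-(s * s)) * Complex.I_mul_I

/-- At a rational angle exp(±iθ) are roots of unity, hence algebraic integers, and so is their sum 2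
cos θ. -/
theorem not_irrational_angle {θ : ℝ} (h : ¬ Irrational (θ / (2 * Real.pi))) :
    IsIntegral ℤ ((2 * Real.cos θ : ℝ) : ℂ) := by
  obtain ⟨x, hx⟩ := not_not.mp h
  have hθ : θ = x * (2 * Real.pi) := by
    rw [hx]; field_simp
  have hx' : (x.den : ℂ) * (x : ℂ) = x.num := by
    exact_mod_cast Rat.den_mul_eq_num x
  have key : ∀ s : ℤ, IsIntegral ℤ (Complex.exp (s * (θ * Complex.I))) := by
    intro s
    refine IsIntegral.of_pow x.den_pos ?_
    rw [← Complex.exp_nat_mul]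
    have : (x.den : ℂ) * (s * (θ * Complex.I))
        = ((s * x.num : ℤ) : ℂ) * (2 * Real.pi * Complex.I) := by
      rw [hθ]
      push_cast
      linear_combination (s * 2 * Real.pi * Complex.I) * hx'
    rw [this, Complex.exp_int_mul_two_pi_mul_I]
    exact isIntegral_one
  have := (key 1).add (key (-1))
  have e : ((2 * Real.cos θ : ℝ) : ℂ)
      = Complex.exp ((1 : ℤ) * (θ * Complex.I)) + Complex.exp ((-1 : ℤ) * (θ * Complex.I)) := by
    push_cast
    rw [Complex.two_cos, one_mul, neg_one_mul, neg_mul]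
  rw [e]
  exact this

/-- The closed group generated by a product of two involutions, if its angle is not a rational
multiple of `π`, contains a one-parameter group. -/
theorem IsGenerator.of_involutions (hS : IsClosed (S : Set (unitary A))) {p q : A}
    (hp : IsSelfAdjoint p) (hq : IsSelfAdjoint q) (hpp : p * p = 1) (hqq : q * q = 1)
    (hpS : ∃ u ∈ S, (u : A) = p) (hqS : ∃ u ∈ S, (u : A) = q) {c : ℝ}
    (hc : p * q + q * p = ((2 * c : ℝ) : ℂ) • (1 : A)) (hc1 : |c| < 1)
    (hint : ¬ IsIntegral ℤ ((2 * c : ℝ) : ℂ)) :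
    IsGenerator S (Complex.I • (p * q - q * p)) := by
  obtain ⟨u, hu, hup⟩ := hpS
  obtain ⟨v, hv, hvq⟩ := hqS
  obtain ⟨hc2, hc3⟩ := abs_lt.mp hc1
  set θ := Real.arccos c with hθ
  have hcos : Real.cos θ = c := Real.cos_arccos hc2.le hc3.le
  have hs0 : Real.sin θ ≠ 0 := by
    rw [hθ, Real.sin_arccos]
    exact (Real.sqrt_pos.mpr (by nlinarith)).ne'
  obtain ⟨r, hr⟩ : ∃ r : ℝ, Real.sin θ = r := ⟨_, rfl⟩
  rw [hr] at hs0
  set s : ℂ := (r : ℂ) with hs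
  have hs0' : s ≠ 0 := Complex.ofReal_ne_zero.mpr hs0
  have hsc : s * s = 1 - c * c := by
    have := Real.sin_sq_add_cos_sq θ
    rw [hcos, hr] at this
    have h2 : r * r = 1 - c * c := by linarith
    rw [hs]
    exact_mod_cast h2
  set d : A := p * q - q * p with hd
  -- Since pq and qp are mutually inverse, (pq + qp)² and (pq - qp)² differ by 4.
  have hdd : d * d = (-(4 * (s * s))) • (1 : A) := by
    have e1 : (p * q + q * p) * (p * q + q * p) = d * d + (4 : ℂ) • (1 : A) := by
      have h1 : p * q * (q * p) = 1 := by rw [mul_assoc, ← mul_assoc q, hqq, one_mul, hpp]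
      have h2 : q * p * (p * q) = 1 := by rw [mul_assoc, ← mul_assoc p, hpp, one_mul, hqq]
      simp only [hd, mul_add, add_mul, mul_sub, sub_mul, h1, h2]
      module
    rw [eq_sub_of_add_eq e1.symm, hc, hsc, smul_mul_smul_comm, one_mul, ← sub_smul]
    congr 1
    push_cast
    ring
  -- The axis of the rotation pq: the normalization makes a an involution and gives pq = cos θ + i
  -- sin θ · a = exp(iθa).
  set a : A := (-(2 * s)⁻¹) • (Complex.I • d) with ha
  have hdsa : IsSelfAdjoint (Complex.I • d) := by
    rw [isSelfAdjoint_iff, star_smul, hd, star_sub, star_mul, star_mul, hp.star_eq, hq.star_eq,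
      Complex.star_def, Complex.conj_I, neg_smul, ← smul_neg, neg_sub]
  have hasa : IsSelfAdjoint a := by
    rw [isSelfAdjoint_iff, ha, star_smul, hdsa.star_eq, hs]
    simp
  have haa : a * a = 1 := by
    rw [ha, smul_smul, smul_mul_smul_comm, hdd, smul_smul]
    convert one_smul ℂ (1 : A) using 2
    field_simp
    linear_combination -4 * Complex.I_sq
  have hU : p * q = exp (((θ : ℂ) * Complex.I) • a) := by
    rw [exp_involution haa, hcos, hr, ha, smul_smul, smul_smul, ← hs]
    have e : s * Complex.I * -(2 * s)⁻¹ * Complex.I = 2⁻¹ := by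
      field_simp
      linear_combination -Complex.I_sq
    rw [e]
    have e2 : (c : ℂ) • (1 : A) = (2⁻¹ : ℂ) • (p * q + q * p) := by
      rw [hc, smul_smul]
      congr 1
      push_cast
      ring
    rw [e2, hd]
    module
  let f : ℝ → unitary A := fun t => ⟨_, exp_mem_unitary hasa t⟩
  have hf : Continuous f := by
    refine Continuous.subtype_mk ?_ _
    simp only [exp_involution haa]
    fun_prop
  have hfadd : ∀ x y, f (x + y) = f x * f y := by
    intro x y
    apply Subtype.ext
    simp only [f, Submonoid.coe_mul, ← exp_smul_add]
    congr 2
    push_cast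
    ring
  have hf0 : f 0 = 1 := by apply Subtype.ext; simp [f]
  let T : AddSubgroup ℝ :=
    { carrier := {t | f t ∈ S}
      add_mem' := fun {x y} hx hy => by
        simp only [Set.mem_ofPred_eq, hfadd] at *
        exact S.mul_mem hx hy
      zero_mem' := by simp only [Set.mem_ofPred_eq, hf0]; exact S.one_mem
      neg_mem' := fun {x} hx => by
        simp only [Set.mem_ofPred_eq] at *
        have : f (-x) = (f x)⁻¹ := by
          rw [eq_inv_iff_mul_eq_one, ← hfadd, neg_add_cancel, hf0]
        rw [this]
        exact S.inv_mem hx }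
  have hT : IsClosed (T : Set ℝ) := hS.preimage hf
  have hθT : θ ∈ T := by
    change f θ ∈ S
    have : f θ = u * v := by
      apply Subtype.ext
      simp only [f, Submonoid.coe_mul, hup, hvq, hU]
    rw [this]
    exact S.mul_mem hu hv
  have hπT : 2 * Real.pi ∈ T := by
    change f (2 * Real.pi) ∈ S
    have : f (2 * Real.pi) = 1 := by
      apply Subtype.ext
      simp only [f, exp_involution haa]
      simp
    rw [this]
    exact S.one_mem
  have hirr : Irrational (θ / (2 * Real.pi)) := by
    by_contra h
    exact hint (hcos ▸ not_irrational_angle h)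
  have hdense : Dense (T : Set ℝ) := by
    refine (dense_addSubgroupClosure_pair_iff.mpr hirr).mono ?_
    have : AddSubgroup.closure {θ, 2 * Real.pi} ≤ T := by
      rw [AddSubgroup.closure_le]
      rintro x (rfl | rfl)
      exacts [hθT, hπT]
    exact this
  have hall : ∀ t, f t ∈ S := by
    intro t
    have : t ∈ (T : Set ℝ) := by
      rw [← hT.closure_eq, hdense.closure_eq]; trivial
    exact this
  have hgen : IsGenerator S a := ⟨hasa, fun t => ⟨f t, hall t, rfl⟩⟩
  have := hgen.smul (-(2 * r))
  rw [ha, smul_smul] at this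
  convert this using 1
  rw [show ((-(2 * r) : ℝ) : ℂ) * -(2 * s)⁻¹ = 1 by
    push_cast; rw [← hs]; field_simp, one_smul]

/-- A unitary whose spectrum omits -1 is exp(ib) for a self-adjoint b, its argument. As the spectrum
is finite, multiplication by a suitable phase moves it off -1, and phases lie in S because 1 is a
generator. -/
theorem eq_top_of_isGenerator
    (hfin : ∀ a : A, (spectrum ℂ a).Finite) (h : ∀ a : A, IsSelfAdjoint a → IsGenerator S a) :
    S = ⊤ := by
  rw [Subgroup.eq_top_iff']
  intro u
  nontriviality A
  have hinf : (Set.range fun t : ℝ => Complex.exp (t * Complex.I)).Infinite := by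
    intro hf
    have hcos : (Set.range Real.cos).Finite := by
      refine (hf.image Complex.re).subset ?_
      rintro _ ⟨t, rfl⟩
      exact ⟨_, ⟨t, rfl⟩, Complex.exp_ofReal_mul_I_re t⟩
    rw [Real.range_cos] at hcos
    exact (Set.Icc_infinite (by norm_num)) hcos
  obtain ⟨_, ⟨t, rfl⟩, ht⟩ := (hinf.sdiff ((hfin u).image fun z => -z)).nonempty
  obtain ⟨v, hv, hv'⟩ := (h 1 (.one A)).2 (-t)
  have hv1 : (v : A) = Complex.exp (-t * Complex.I) • (1 : A) := by
    rw [hv', exp_involution (one_mul 1), Complex.exp_mul_I]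
    simp only [Complex.ofReal_cos, Complex.ofReal_sin, Complex.ofReal_neg]
    module
  have hspec : (-1 : ℂ) ∉ spectrum ℂ ((v * u : unitary A) : A) := by
    intro hmem
    rw [Submonoid.coe_mul, hv1, smul_mul_assoc, one_mul,
      spectrum.smul_eq_smul _ _ (spectrum.nonempty _)] at hmem
    obtain ⟨z, hz, hz'⟩ := hmem
    refine ht ⟨z, hz, ?_⟩
    simp only [smul_eq_mul] at hz'
    have : Complex.exp (t * Complex.I) * (Complex.exp (-t * Complex.I) * z) = z := by
      rw [← mul_assoc, ← Complex.exp_add]; simp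
    rw [hz'] at this
    simp [← this]
  have hlt := (Unitary.norm_sub_one_lt_two_iff (v * u).2).mpr hspec
  obtain ⟨w, hw, hw'⟩ := (h _ (Unitary.argSelfAdjoint (v * u)).2).2 1
  have : w = v * u := by
    rw [← expUnitary_argSelfAdjoint hlt]
    apply Subtype.ext
    rw [hw', selfAdjoint.expUnitary_coe]
    simp
  have hu : u = v⁻¹ * w := by rw [this]; group
  rw [hu]
  exact S.mul_mem (S.inv_mem hv) hw

end OneParameter

/-! ### Identities for one-qubit gates and Pauli matrices -/

section Gates

/-- The complex number `1 / √2`. -/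
noncomputable def invSqrtTwo : ℂ := ((Real.sqrt 2 : ℝ) : ℂ)⁻¹

theorem invSqrtTwo_mul_self : invSqrtTwo * invSqrtTwo = 2⁻¹ := by
  rw [invSqrtTwo, ← mul_inv, ← Complex.ofReal_mul, Real.mul_self_sqrt (by norm_num)]
  norm_num

theorem conj_invSqrtTwo : (starRingEnd ℂ) invSqrtTwo = invSqrtTwo := by
  rw [invSqrtTwo, map_inv₀, Complex.conj_ofReal]

/-- The Hadamard gate. -/
noncomputable def hadamard : Matrix (Fin 2) (Fin 2) ℂ :=
  !![invSqrtTwo, invSqrtTwo; invSqrtTwo, -invSqrtTwo]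

/-- The product `H T` of the Hadamard gate and the `π / 8` gate. -/
noncomputable def gateHT : Matrix (Fin 2) (Fin 2) ℂ :=
  !![invSqrtTwo, (1 + Complex.I) / 2; invSqrtTwo, -((1 + Complex.I) / 2)]

/-- The Pauli matrices, labelled by their `X` and `Z` parts. -/
noncomputable def pauli : Bool × Bool → Matrix (Fin 2) (Fin 2) ℂ
  | (false, false) => 1
  | (true, false) => pauliX
  | (false, true) => pauliZ
  | (true, true) => pauliY

theorem pauli_hermitian (s : Bool × Bool) : (pauli s).IsHermitian := by
  rcases s with ⟨_ | _, _ | _⟩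
  · exact Matrix.isHermitian_one
  · exact pauliZ_hermitian
  · exact pauliX_hermitian
  · ext i j
    fin_cases i <;> fin_cases j <;> simp [pauli, pauliY]

theorem pauli_sq (s : Bool × Bool) : pauli s * pauli s = 1 := by
  rcases s with ⟨_ | _, _ | _⟩
  · exact one_mul 1
  · exact pauliZ_sq
  · exact pauliX_sq
  · ext i j
    fin_cases i <;> fin_cases j <;> simp [pauli, pauliY]

/-- The label of the product of two Pauli matrices. -/
def pauliAdd (s t : Bool × Bool) : Bool × Bool := (xor s.1 t.1, xor s.2 t.2)

theorem pauli_mul (s t : Bool × Bool) :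
    ∃ z : ℂ, z ≠ 0 ∧ pauli s * pauli t = z • pauli (pauliAdd s t) := by
  have e1 : pauliX * pauliY = Complex.I • pauliZ := by
    ext i j; fin_cases i <;> fin_cases j <;> simp [pauliX, pauliY, pauliZ]
  have e2 : pauliY * pauliX = (-Complex.I) • pauliZ := by
    ext i j; fin_cases i <;> fin_cases j <;> simp [pauliX, pauliY, pauliZ]
  have e3 : pauliY * pauliZ = Complex.I • pauliX := by
    ext i j; fin_cases i <;> fin_cases j <;> simp [pauliX, pauliY, pauliZ]
  have e4 : pauliZ * pauliY = (-Complex.I) • pauliX := by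
    ext i j; fin_cases i <;> fin_cases j <;> simp [pauliX, pauliY, pauliZ]
  have e5 : pauliZ * pauliX = Complex.I • pauliY := by
    ext i j; fin_cases i <;> fin_cases j <;> simp [pauliX, pauliY, pauliZ]
  have e6 : pauliX * pauliZ = (-Complex.I) • pauliY := by
    ext i j; fin_cases i <;> fin_cases j <;> simp [pauliX, pauliY, pauliZ]
  have h := pauli_sq (true, true)
  have hI : -Complex.I ≠ 0 := neg_ne_zero.mpr Complex.I_ne_zero
  rcases s with ⟨_ | _, _ | _⟩ <;> rcases t with ⟨_ | _, _ | _⟩ <;>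
    simp only [pauli, pauliAdd, Bool.xor_false, Bool.xor_true, Bool.not_false, Bool.not_true,
      one_mul, mul_one, pauliX_sq, pauliZ_sq, e1, e2, e3, e4, e5, e6] at h ⊢
  all_goals first
    | exact ⟨1, one_ne_zero, (one_smul _ _).symm⟩
    | exact ⟨_, Complex.I_ne_zero, rfl⟩
    | exact ⟨_, hI, rfl⟩
    | exact ⟨1, one_ne_zero, h.trans (one_smul _ _).symm⟩

/-- Two different nontrivial Paulis are exchanged, up to sign, by a quarter turn about the third.
The statement has the form that `IsGenerator.I_smul_mul` takes. -/
theorem pauli_rotate {s t : Bool × Bool} (hs : s ≠ (false, false)) (ht : t ≠ (false, false))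
    (hst : s ≠ t) : pauliAdd s t ≠ (false, false) ∧
      pauli s * pauli (pauliAdd s t) = -(pauli (pauliAdd s t) * pauli s) ∧
      ∃ r : ℝ, (r : ℂ) • (Complex.I • (pauli (pauliAdd s t) * pauli s)) = pauli t := by
  refine ⟨?_, ?_, ?_⟩
  · rcases s with ⟨_ | _, _ | _⟩ <;> rcases t with ⟨_ | _, _ | _⟩ <;> simp_all [pauliAdd]
  · rcases s with ⟨_ | _, _ | _⟩ <;> rcases t with ⟨_ | _, _ | _⟩ <;> simp at hs ht hst <;>
      ext i j <;> fin_cases i <;> fin_cases j <;>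
      simp [pauliAdd, pauli, pauliX, pauliY, pauliZ]
  · rcases s with ⟨_ | _, _ | _⟩ <;> rcases t with ⟨_ | _, _ | _⟩ <;> simp at hs ht hst
    all_goals first
      | (refine ⟨1, ?_⟩
         ext i j
         fin_cases i <;> fin_cases j <;> simp [pauliAdd, pauli, pauliX, pauliY, pauliZ]
         done)
      | (refine ⟨-1, ?_⟩
         ext i j
         fin_cases i <;> fin_cases j <;> simp [pauliAdd, pauli, pauliX, pauliY, pauliZ])

theorem hadamard_eq : hadamard = invSqrtTwo • (pauliX + pauliZ) := by
  ext i j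
  fin_cases i <;> fin_cases j <;> simp [hadamard, pauliX, pauliZ]

theorem hadamard_sq : hadamard * hadamard = 1 := by
  have h := invSqrtTwo_mul_self
  ext i j
  fin_cases i <;> fin_cases j <;> simp [hadamard] <;> grind

theorem gateHT_mul_conjTranspose : gateHT * gateHT.conjTranspose = 1 := by
  have h2 : (starRingEnd ℂ) 2 = 2 := map_ofNat _ 2
  have h := invSqrtTwo_mul_self
  have hI := Complex.I_mul_I
  ext i j
  fin_cases i <;> fin_cases j <;>
    simp [gateHT, Matrix.mul_apply, Matrix.conjTranspose_apply, conj_invSqrtTwo, h2] <;> grind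

theorem conjTranspose_gateHT_mul : gateHT.conjTranspose * gateHT = 1 :=
  mul_eq_one_comm.mp gateHT_mul_conjTranspose

theorem gateHT_mul_pauliZ : gateHT * pauliZ = pauliX * gateHT := by
  ext i j
  fin_cases i <;> fin_cases j <;> simp [gateHT, pauliX, pauliZ]

/-- The image of `X` under threefold conjugation by `H T`. -/
noncomputable def tiltedPauli : Matrix (Fin 2) (Fin 2) ℂ :=
  !![(1 - invSqrtTwo) / 2, 1 / 2 + (1 + invSqrtTwo) / 2 * Complex.I;
    1 / 2 - (1 + invSqrtTwo) / 2 * Complex.I, -((1 - invSqrtTwo) / 2)]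

theorem tiltedPauli_eq : gateHT * (gateHT * (gateHT * pauliX * gateHT.conjTranspose)
    * gateHT.conjTranspose) * gateHT.conjTranspose = tiltedPauli := by
  have h := invSqrtTwo_mul_self
  have hI := Complex.I_mul_I
  have e1 : gateHT * pauliX = !![invSqrtTwo, invSqrtTwo * Complex.I;
      -(invSqrtTwo * Complex.I), -invSqrtTwo] * gateHT := by
    ext i j
    fin_cases i <;> fin_cases j <;> simp [gateHT, pauliX] <;> grind
  have e2 : gateHT * !![invSqrtTwo, invSqrtTwo * Complex.I;
      -(invSqrtTwo * Complex.I), -invSqrtTwo] = !![1 / 2, invSqrtTwo - Complex.I / 2;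
      invSqrtTwo + Complex.I / 2, -(1 / 2)] * gateHT := by
    ext i j
    fin_cases i <;> fin_cases j <;> simp [gateHT] <;> grind
  have e3 : gateHT * !![1 / 2, invSqrtTwo - Complex.I / 2;
      invSqrtTwo + Complex.I / 2, -(1 / 2)] = tiltedPauli * gateHT := by
    ext i j
    fin_cases i <;> fin_cases j <;> simp [gateHT, tiltedPauli] <;> grind
  rw [e1, mul_assoc _ gateHT, gateHT_mul_conjTranspose, mul_one, e2, mul_assoc _ gateHT,
    gateHT_mul_conjTranspose, mul_one, e3, mul_assoc _ gateHT, gateHT_mul_conjTranspose, mul_one]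

/-- The scalar on the right is 2 cos θ for the rotation angle θ of the product of the two
involutions. -/
theorem tiltedPauli_add : tiltedPauli * pauliZ + pauliZ * tiltedPauli
    = (1 - invSqrtTwo) • (1 : Matrix (Fin 2) (Fin 2) ℂ) := by
  ext i j
  fin_cases i <;> fin_cases j <;> simp [tiltedPauli, pauliZ]

theorem tiltedPauli_sub : Complex.I • (tiltedPauli * pauliZ - pauliZ * tiltedPauli)
    = (1 + invSqrtTwo) • pauliX + pauliY := by
  have hI := Complex.I_mul_I
  ext i j
  fin_cases i <;> fin_cases j <;> simp [tiltedPauli, pauliX, pauliY, pauliZ] <;> grind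

/-- Otherwise 1/√2 and its square 1/2 would be integral, but ℤ is integrally closed. -/
theorem not_isIntegral_one_sub_invSqrtTwo : ¬ IsIntegral ℤ (1 - invSqrtTwo) := by
  intro h
  have h1 : IsIntegral ℤ invSqrtTwo := by simpa using isIntegral_one.sub h
  have h2 : IsIntegral ℤ ((2⁻¹ : ℚ) : ℂ) := by
    have := h1.mul h1
    rw [invSqrtTwo_mul_self] at this
    simpa using this
  have h3 : IsIntegral ℤ (2⁻¹ : ℚ) := by
    have : ((2⁻¹ : ℚ) : ℂ) = algebraMap ℚ ℂ 2⁻¹ := rfl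
    rw [this] at h2
    exact (isIntegral_algebraMap_iff (algebraMap ℚ ℂ).injective).mp h2
  obtain ⟨y, hy⟩ := IsIntegrallyClosed.isIntegral_iff.mp h3
  have h4 : (2 : ℚ) * y = 1 := by
    have : (y : ℚ) = 2⁻¹ := hy
    rw [this]; norm_num
  have h5 : (2 : ℤ) * y = 1 := by exact_mod_cast h4
  omega

end Gates

/-! ### Tensor products, one-qubit operators and controlled Z -/

section Register

variable {n : ℕ}

theorem tensor_mul (A B : Fin n → Matrix (Fin 2) (Fin 2) ℂ) :
    tensor A * tensor B = tensor fun i => A i * B i := by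
  ext x z
  simp only [tensor, Matrix.mul_apply, Matrix.of_apply, ← Finset.prod_mul_distrib]
  exact (Fintype.prod_sum (fun i b => A i (x i) b * B i b (z i))).symm

theorem tensor_one : tensor (fun _ : Fin n => (1 : Matrix (Fin 2) (Fin 2) ℂ)) = 1 := by
  ext x y
  simp only [tensor, Matrix.of_apply, Matrix.one_apply]
  by_cases h : x = y
  · simp [h]
  · obtain ⟨i, hi⟩ := Function.ne_iff.mp h
    rw [if_neg h]
    exact Finset.prod_eq_zero (Finset.mem_univ i) (if_neg hi)

theorem conjTranspose_tensor (A : Fin n → Matrix (Fin 2) (Fin 2) ℂ) :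
    (tensor A).conjTranspose = tensor fun i => (A i).conjTranspose := by
  ext x y
  simp [tensor, Matrix.conjTranspose_apply]

theorem prod_update_entry (A : Fin n → Matrix (Fin 2) (Fin 2) ℂ) (j : Fin n)
    (M : Matrix (Fin 2) (Fin 2) ℂ) (x y : Fin n → Fin 2) :
    tensor (Function.update A j M) x y
      = M (x j) (y j) * ∏ i ∈ Finset.univ.erase j, A i (x i) (y i) := by
  rw [tensor, Matrix.of_apply, ← Finset.mul_prod_erase _ _ (Finset.mem_univ j)]
  simp only [Function.update_self]
  congr 1
  refine Finset.prod_congr rfl fun i hi => ?_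
  rw [Function.update_of_ne (Finset.ne_of_mem_erase hi)]

theorem tensor_update_add (A : Fin n → Matrix (Fin 2) (Fin 2) ℂ) (j : Fin n)
    (M N : Matrix (Fin 2) (Fin 2) ℂ) : tensor (Function.update A j (M + N))
      = tensor (Function.update A j M) + tensor (Function.update A j N) := by
  ext x y
  simp only [prod_update_entry, Matrix.add_apply, add_mul]

theorem tensor_update_smul (A : Fin n → Matrix (Fin 2) (Fin 2) ℂ) (j : Fin n) (z : ℂ)
    (M : Matrix (Fin 2) (Fin 2) ℂ) : tensor (Function.update A j (z • M))
      = z • tensor (Function.update A j M) := by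
  ext x y
  simp only [prod_update_entry, Matrix.smul_apply, smul_eq_mul, mul_assoc]

/-- The one-qubit operator `M` acting on the qubit `j`. -/
noncomputable def oneQubit (j : Fin n) (M : Matrix (Fin 2) (Fin 2) ℂ) : Op (Fin n) :=
  tensor (Function.update (fun _ => 1) j M)

theorem oneQubit_mul_tensor (j : Fin n) (M : Matrix (Fin 2) (Fin 2) ℂ)
    (A : Fin n → Matrix (Fin 2) (Fin 2) ℂ) :
    oneQubit j M * tensor A = tensor (Function.update A j (M * A j)) := by
  rw [oneQubit, tensor_mul]
  congr 1
  funext i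
  rcases eq_or_ne i j with rfl | h
  · simp
  · simp [Function.update_of_ne h]

theorem tensor_mul_oneQubit (j : Fin n) (M : Matrix (Fin 2) (Fin 2) ℂ)
    (A : Fin n → Matrix (Fin 2) (Fin 2) ℂ) :
    tensor A * oneQubit j M = tensor (Function.update A j (A j * M)) := by
  rw [oneQubit, tensor_mul]
  congr 1
  funext i
  rcases eq_or_ne i j with rfl | h
  · simp
  · simp [Function.update_of_ne h]

theorem oneQubit_mul (j : Fin n) (M N : Matrix (Fin 2) (Fin 2) ℂ) :
    oneQubit j M * oneQubit j N = oneQubit j (M * N) := by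
  conv_lhs => rw [oneQubit.eq_1 j N]
  rw [oneQubit_mul_tensor]
  simp [oneQubit]

theorem oneQubit_one (j : Fin n) : oneQubit j 1 = 1 := by
  rw [oneQubit, Function.update_eq_self, tensor_one]

theorem oneQubit_add (j : Fin n) (M N : Matrix (Fin 2) (Fin 2) ℂ) :
    oneQubit j (M + N) = oneQubit j M + oneQubit j N := tensor_update_add _ _ _ _

theorem oneQubit_smul (j : Fin n) (z : ℂ) (M : Matrix (Fin 2) (Fin 2) ℂ) :
    oneQubit j (z • M) = z • oneQubit j M := tensor_update_smul _ _ _ _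

theorem oneQubit_neg (j : Fin n) (M : Matrix (Fin 2) (Fin 2) ℂ) :
    oneQubit j (-M) = -oneQubit j M := by
  rw [← neg_one_smul ℂ M, oneQubit_smul, neg_one_smul]

theorem oneQubit_sub (j : Fin n) (M N : Matrix (Fin 2) (Fin 2) ℂ) :
    oneQubit j (M - N) = oneQubit j M - oneQubit j N := by
  rw [sub_eq_add_neg, oneQubit_add, oneQubit_neg, sub_eq_add_neg]

theorem conjTranspose_oneQubit (j : Fin n) (M : Matrix (Fin 2) (Fin 2) ℂ) :
    (oneQubit j M).conjTranspose = oneQubit j M.conjTranspose := by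
  rw [oneQubit, conjTranspose_tensor, oneQubit]
  congr 1
  funext i
  rcases eq_or_ne i j with rfl | h
  · simp
  · simp [Function.update_of_ne h]

theorem oneQubit_mem_unitaryGroup (j : Fin n) {M : Matrix (Fin 2) (Fin 2) ℂ}
    (hM : M * M.conjTranspose = 1) : oneQubit j M ∈ Matrix.unitaryGroup (Fin n → Fin 2) ℂ := by
  rw [Matrix.mem_unitaryGroup_iff, Matrix.star_eq_conjTranspose, conjTranspose_oneQubit,
    oneQubit_mul, hM, oneQubit_one]

/-- The controlled-`Z` gate on the qubits `a` and `b`. -/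
def gateCZ (a b : Fin n) : Op (Fin n) :=
  Matrix.diagonal fun x => if x a = 1 ∧ x b = 1 then -1 else 1

theorem gateCZ_sq (a b : Fin n) : gateCZ a b * gateCZ a b = 1 := by
  rw [gateCZ, Matrix.diagonal_mul_diagonal, ← Matrix.diagonal_one]
  congr 1
  funext x
  split_ifs <;> norm_num

theorem gateCZ_conjTranspose (a b : Fin n) : (gateCZ a b).conjTranspose = gateCZ a b := by
  rw [gateCZ, Matrix.diagonal_conjTranspose]
  congr 1
  funext x
  simp only [Pi.star_apply]
  split_ifs <;> simp

theorem gateCZ_mem_unitaryGroup (a b : Fin n) :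
    gateCZ a b ∈ Matrix.unitaryGroup (Fin n → Fin 2) ℂ := by
  rw [Matrix.mem_unitaryGroup_iff, Matrix.star_eq_conjTranspose, gateCZ_conjTranspose, gateCZ_sq]

/-- The entangling relation: conjugation by CZ turns X on one qubit into X ⊗ Z, which enlarges the
support of a Pauli string. -/
theorem gateCZ_mul_tensor {a b : Fin n} (hab : a ≠ b) (A : Fin n → Matrix (Fin 2) (Fin 2) ℂ)
    (ha : A a = pauliX) (hb : A b = 1) :
    gateCZ a b * tensor A = tensor (Function.update A b pauliZ) * gateCZ a b := by
  ext x y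
  have hA : tensor A x y = A b (x b) (y b) * (A a (x a) (y a)
      * ∏ i ∈ (Finset.univ.erase b).erase a, A i (x i) (y i)) := by
    rw [Finset.mul_prod_erase _ (fun i => A i (x i) (y i)) (by simp [hab]),
      Finset.mul_prod_erase _ (fun i => A i (x i) (y i)) (Finset.mem_univ b)]
    rfl
  rw [gateCZ, Matrix.diagonal_mul, Matrix.mul_diagonal, prod_update_entry, hA,
    ← Finset.mul_prod_erase (Finset.univ.erase b) (fun i => A i (x i) (y i)) (a := a)
      (by simp [hab]), ha, hb]
  generalize ∏ i ∈ (Finset.univ.erase b).erase a, A i (x i) (y i) = r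
  generalize x a = xa, y a = ya, x b = xb, y b = yb
  fin_cases xa <;> fin_cases ya <;> fin_cases xb <;> fin_cases yb <;> simp [pauliX, pauliZ]

end Register

/-! ### Expansion in Pauli strings -/

section PauliBasis

variable {n : ℕ}

/-- The tensor product of the Pauli matrices with the given labels. -/
noncomputable def pauliString (f : Fin n → Bool × Bool) : Op (Fin n) := tensor fun i => pauli (f i)

theorem pauliString_hermitian (f : Fin n → Bool × Bool) : (pauliString f).IsHermitian :=
  tensor_hermitian _ fun _ => pauli_hermitian _

theorem pauliString_update (f : Fin n → Bool × Bool) (j : Fin n) (s : Bool × Bool) :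
    pauliString (Function.update f j s)
      = tensor (Function.update (fun i => pauli (f i)) j (pauli s)) := by
  rw [pauliString]
  congr 1
  funext i
  rcases eq_or_ne i j with rfl | h
  · simp
  · simp [Function.update_of_ne h]

theorem oneQubit_pauli_mul_pauliString (j : Fin n) (s : Bool × Bool) (f : Fin n → Bool × Bool) :
    oneQubit j (pauli s) * pauliString f
      = tensor (Function.update (fun i => pauli (f i)) j (pauli s * pauli (f j))) :=
  oneQubit_mul_tensor _ _ _

theorem single_eq_sum_pauli (x y : Fin 2) :
    ∃ c : Bool × Bool → ℂ, Matrix.single x y (1 : ℂ) = ∑ s, c s • pauli s := by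
  have hI := Complex.I_mul_I
  fin_cases x <;> fin_cases y
  · refine ⟨fun s => if s.1 then 0 else 2⁻¹, ?_⟩
    ext i j
    fin_cases i <;> fin_cases j <;>
      simp [Fintype.sum_prod_type, pauli, pauliX, pauliY, pauliZ, Matrix.single] <;> norm_num
  · refine ⟨fun s => if s.1 then (if s.2 then Complex.I / 2 else 2⁻¹) else 0, ?_⟩
    ext i j
    fin_cases i <;> fin_cases j <;>
      simp [Fintype.sum_prod_type, pauli, pauliX, pauliY, pauliZ, Matrix.single] <;> grind
  · refine ⟨fun s => if s.1 then (if s.2 then -Complex.I / 2 else 2⁻¹) else 0, ?_⟩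
    ext i j
    fin_cases i <;> fin_cases j <;>
      simp [Fintype.sum_prod_type, pauli, pauliX, pauliY, pauliZ, Matrix.single] <;> grind
  · refine ⟨fun s => if s.1 then 0 else (if s.2 then -2⁻¹ else 2⁻¹), ?_⟩
    ext i j
    fin_cases i <;> fin_cases j <;>
      simp [Fintype.sum_prod_type, pauli, pauliX, pauliY, pauliZ, Matrix.single] <;> norm_num

/-- The Pauli strings span all operators. -/
theorem exists_eq_sum_pauliString (A : Op (Fin n)) :
    ∃ d : (Fin n → Bool × Bool) → ℂ, A = ∑ f, d f • pauliString f := by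
  choose c hc using single_eq_sum_pauli
  have h1 : ∀ x y : Fin n → Fin 2, Matrix.single x y (1 : ℂ)
      = ∑ f : Fin n → Bool × Bool, (∏ i, c (x i) (y i) (f i)) • pauliString f := by
    intro x y
    have h2 : Matrix.single x y (1 : ℂ) = tensor fun i => Matrix.single (x i) (y i) (1 : ℂ) := by
      ext u v
      simp only [tensor, Matrix.of_apply, Matrix.single_apply]
      rw [Fintype.prod_ite_zero]
      simp only [Finset.prod_const_one, funext_iff, forall_and]
    rw [h2]
    ext u v
    simp only [tensor, Matrix.of_apply, hc, Matrix.sum_apply, Matrix.smul_apply, smul_eq_mul,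
      pauliString, ← Finset.prod_mul_distrib]
    exact Fintype.prod_sum (fun i s => c (x i) (y i) s * pauli s (u i) (v i))
  refine ⟨fun f => ∑ x, ∑ y, A x y * ∏ i, c (x i) (y i) (f i), ?_⟩
  conv_lhs => rw [Matrix.matrix_eq_sum_single A]
  simp only [Finset.sum_smul, mul_smul]
  rw [Finset.sum_comm]
  refine Eq.symm ?_
  rw [Finset.sum_comm]
  have h3 : ∀ x, ∑ f : Fin n → Bool × Bool, ∑ y, A x y • (∏ i, c (x i) (y i) (f i)) • pauliString f
      = ∑ y, Matrix.single x y (A x y) := by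
    intro x
    rw [Finset.sum_comm]
    refine Finset.sum_congr rfl fun y _ => ?_
    rw [← Finset.smul_sum, ← h1, Matrix.smul_single, smul_eq_mul, mul_one]
  simp only [h3]
  rw [Finset.sum_comm]

/-- Averaging an expansion of A with its adjoint makes the coefficients real, so linear independence
of the strings is not needed. -/
theorem exists_eq_real_sum_pauliString {A : Op (Fin n)} (hA : A.IsHermitian) :
    ∃ d : (Fin n → Bool × Bool) → ℝ, A = ∑ f, (d f : ℂ) • pauliString f := by
  obtain ⟨d, hd⟩ := exists_eq_sum_pauliString A
  refine ⟨fun f => (d f).re, ?_⟩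
  have h1 : A = ∑ f, star (d f) • pauliString f := by
    conv_lhs => rw [← hA.eq, hd, Matrix.conjTranspose_sum]
    refine Finset.sum_congr rfl fun f _ => ?_
    rw [Matrix.conjTranspose_smul, (pauliString_hermitian f).eq]
  have h2 : A = (2⁻¹ : ℂ) • (A + A) := by rw [← two_smul ℂ A, smul_smul]; norm_num
  rw [h2]
  conv_lhs => rw [hd]
  conv_lhs => arg 2; arg 2; rw [← hd, h1]
  rw [← Finset.sum_add_distrib, Finset.smul_sum]
  refine Finset.sum_congr rfl fun f _ => ?_
  rw [← add_smul, smul_smul]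
  congr 1
  rw [Complex.star_def, Complex.add_conj]
  push_cast
  ring

end PauliBasis

/-! ### Density of the gate set -/

section Density

open scoped Matrix.Norms.L2Operator

variable {n : ℕ} {S : Subgroup (unitary (Op (Fin n)))}

theorem isGenerator_one
    (hphase : ∀ z : ℂ, ‖z‖ = 1 → ∃ u ∈ S, (u : Op (Fin n)) = z • 1) :
    IsGenerator S (1 : Op (Fin n)) := by
  refine ⟨IsSelfAdjoint.one _, fun t => ?_⟩
  obtain ⟨v, hv, hv'⟩ := hphase (Complex.exp (t * Complex.I)) (Complex.norm_exp_ofReal_mul_I t)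
  refine ⟨v, hv, ?_⟩
  rw [exp_involution (one_mul 1), hv', Complex.exp_mul_I, ← add_smul]
  simp

/-- The irrational rotation about the axis of (1 + 1/√2)X + Y is the only analytic input.
Conjugation by X flips Y, which separates X from Y, and Z then arises as the product of the two. -/
theorem isGenerator_oneQubit_pauli (hS : IsClosed (S : Set (unitary (Op (Fin n)))))
    (hphase : ∀ z : ℂ, ‖z‖ = 1 → ∃ u ∈ S, (u : Op (Fin n)) = z • 1) (j : Fin n)
    (hP : ∀ s, ∃ u ∈ S, (u : Op (Fin n)) = oneQubit j (pauli s))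
    (hW : ∃ u ∈ S, (u : Op (Fin n)) = oneQubit j gateHT) (s : Bool × Bool) :
    IsGenerator S (oneQubit j (pauli s)) := by
  have hsa : ∀ {M : Matrix (Fin 2) (Fin 2) ℂ}, M.IsHermitian →
      IsSelfAdjoint (oneQubit j M : Op (Fin n)) := by
    intro M hM
    rw [isSelfAdjoint_iff, Matrix.star_eq_conjTranspose, conjTranspose_oneQubit, hM.eq]
  have hone : ∀ M N : Matrix (Fin 2) (Fin 2) ℂ, M * N = 1 →
      (oneQubit j M * oneQubit j N : Op (Fin n)) = 1 := by
    intro M N h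
    rw [oneQubit_mul, h, oneQubit_one]
  have hTilted : ∃ u ∈ S, (u : Op (Fin n)) = oneQubit j tiltedPauli := by
    obtain ⟨w, hw, hw'⟩ := hW
    obtain ⟨x, hx, hx'⟩ := hP (true, false)
    refine ⟨w * (w * (w * x * w⁻¹) * w⁻¹) * w⁻¹, ?_, ?_⟩
    · have hwi := S.inv_mem hw
      exact S.mul_mem (S.mul_mem hw (S.mul_mem (S.mul_mem hw
        (S.mul_mem (S.mul_mem hw hx) hwi)) hwi)) hwi
    · have e : ((w⁻¹ : unitary (Op (Fin n))) : Op (Fin n)) = oneQubit j gateHT.conjTranspose := by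
        have : ((w⁻¹ : unitary (Op (Fin n))) : Op (Fin n)) = star (w : Op (Fin n)) := rfl
        rw [this, hw', Matrix.star_eq_conjTranspose, conjTranspose_oneQubit]
      simp only [Submonoid.coe_mul, e, hw', hx', oneQubit_mul, pauli]
      rw [tiltedPauli_eq]
  have hMherm : tiltedPauli.IsHermitian := by
    rw [← tiltedPauli_eq]
    simp only [Matrix.IsHermitian, Matrix.conjTranspose_mul, Matrix.conjTranspose_conjTranspose,
      pauliX_hermitian.eq, mul_assoc]
  have hMsq : tiltedPauli * tiltedPauli = 1 := by
    rw [← tiltedPauli_eq]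
    have h := conjTranspose_gateHT_mul
    have h' : ∀ M, gateHT.conjTranspose * (gateHT * M) = M := fun M => by
      rw [← mul_assoc, h, one_mul]
    have h'' : ∀ M, pauliX * (pauliX * M) = M := fun M => by
      rw [← mul_assoc, pauliX_sq, one_mul]
    have h3 : ∀ M, gateHT * (gateHT.conjTranspose * M) = M := fun M => by
      rw [← mul_assoc, gateHT_mul_conjTranspose, one_mul]
    simp only [mul_assoc, h', h'', h3, gateHT_mul_conjTranspose]
  set r : ℝ := (Real.sqrt 2)⁻¹ with hr
  have hrs : invSqrtTwo = (r : ℂ) := by rw [invSqrtTwo, hr, Complex.ofReal_inv]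
  have hr0 : 0 < r := by positivity
  have hr1 : r < 1 := by
    rw [hr]
    exact inv_lt_one_of_one_lt₀ (by rw [Real.lt_sqrt] <;> norm_num)
  have hD : IsGenerator S (oneQubit j ((1 + invSqrtTwo) • pauliX + pauliY)) := by
    have := IsGenerator.of_involutions hS (hsa hMherm) (hsa pauliZ_hermitian)
      (hone _ _ hMsq) (hone _ _ pauliZ_sq) hTilted (hP (false, true)) (c := (1 - r) / 2) (by
        rw [oneQubit_mul, oneQubit_mul, ← oneQubit_add, tiltedPauli_add, oneQubit_smul,
          oneQubit_one, hrs]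
        congr 1
        push_cast
        ring) (by rw [abs_lt]; constructor <;> linarith) (by
        have : ((2 * ((1 - r) / 2) : ℝ) : ℂ) = 1 - invSqrtTwo := by rw [hrs]; push_cast; ring
        rw [this]
        exact not_isIntegral_one_sub_invSqrtTwo)
    rwa [oneQubit_mul, oneQubit_mul, ← oneQubit_sub, ← oneQubit_smul, tiltedPauli_sub] at this
  have hX : IsGenerator S (oneQubit j pauliX) := by
    obtain ⟨x, hx, hx'⟩ := hP (true, false)
    have h1 := hD.conj hx
    rw [hx', Matrix.star_eq_conjTranspose, conjTranspose_oneQubit, (pauli_hermitian _).eq,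
      oneQubit_mul, oneQubit_mul] at h1
    -- The sum of (1 + r)X + Y and its conjugate (1 + r)X - Y is 2(1 + r)X.
    have h2 := (hD.add hS h1).smul (2 * (1 + r))⁻¹
    rw [← oneQubit_add, ← oneQubit_smul] at h2
    convert h2 using 2
    have hr' : (1 + (r : ℂ)) ≠ 0 := by exact_mod_cast (by positivity : 1 + r ≠ 0)
    rw [hrs]
    ext a b
    fin_cases a <;> fin_cases b <;>
      simp [pauli, pauliX, pauliY] <;> field_simp <;> ring
  have hY : IsGenerator S (oneQubit j pauliY) := by
    have h2 := hD.add hS (hX.smul (-(1 + r)))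
    rw [← oneQubit_smul, ← oneQubit_add] at h2
    convert h2 using 2
    rw [hrs]
    push_cast
    module
  rcases s with ⟨_ | _, _ | _⟩
  · rw [pauli, oneQubit_one]
    exact isGenerator_one hphase
  · obtain ⟨-, h1, c, h2⟩ := pauli_rotate (s := (true, false)) (t := (false, true))
      (by simp) (by simp) (by simp)
    have := (IsGenerator.I_smul_mul hX hY (hone _ _ (pauli_sq (true, true))) (by
      have h1' : pauliX * pauliY = -(pauliY * pauliX) := h1
      rw [oneQubit_mul, oneQubit_mul, h1', oneQubit_neg])).smul c
    rw [oneQubit_mul, ← oneQubit_smul, ← oneQubit_smul] at this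
    exact (congrArg (fun M => IsGenerator S (oneQubit j M)) h2).mp this
  · exact hX
  · exact hY

/-- Induction on the support. One-qubit rotations change any nontrivial label into any other, and CZ
supplies one new nontrivial label. -/
theorem isGenerator_pauliString
    (hphase : ∀ z : ℂ, ‖z‖ = 1 → ∃ u ∈ S, (u : Op (Fin n)) = z • 1)
    (hG : ∀ j s, IsGenerator S (oneQubit j (pauli s)))
    (hCZ : ∀ a b, a ≠ b → ∃ u ∈ S, (u : Op (Fin n)) = gateCZ a b) (f : Fin n → Bool × Bool) :
    IsGenerator S (pauliString f) := by
  have hchange : ∀ (g : Fin n → Bool × Bool) (j : Fin n) (t : Bool × Bool),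
      g j ≠ (false, false) → t ≠ (false, false) → IsGenerator S (pauliString g) →
      IsGenerator S (pauliString (Function.update g j t)) := by
    intro g j t hg ht hgen
    rcases eq_or_ne (g j) t with h | h
    · rwa [← h, Function.update_eq_self]
    obtain ⟨-, h1, c, h2⟩ := pauli_rotate hg ht h
    have h3 := (hgen.I_smul_mul (hG j (pauliAdd (g j) t)) (by
      rw [oneQubit_mul, pauli_sq, oneQubit_one]) (by
      rw [oneQubit_pauli_mul_pauliString, pauliString, tensor_mul_oneQubit, h1,
        ← neg_one_smul ℂ (pauli _ * pauli _), tensor_update_smul, neg_one_smul])).smul c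
    rw [oneQubit_pauli_mul_pauliString, ← tensor_update_smul, ← tensor_update_smul, h2,
      ← pauliString_update] at h3
    exact h3
  suffices h : ∀ (T : Finset (Fin n)) (g : Fin n → Bool × Bool),
      (∀ i ∉ T, g i = (false, false)) → IsGenerator S (pauliString g) from
    h Finset.univ f (by simp)
  intro T
  induction T using Finset.induction_on with
  | empty =>
    intro g hg
    have : pauliString g = 1 := by
      rw [pauliString, ← tensor_one]
      congr 1
      funext i
      rw [hg i (by simp)]
      rfl
    rw [this]
    exact isGenerator_one hphase
  | insert b T hb ih =>
    intro g hg
    by_cases hgb : g b = (false, false)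
    · refine ih g fun i hi => ?_
      rcases eq_or_ne i b with rfl | hib
      · exact hgb
      · exact hg i (by simp [hib, hi])
    by_cases hT : ∃ a, a ≠ b ∧ g a ≠ (false, false)
    · obtain ⟨a, hab, hga⟩ := hT
      have haT : a ∈ T := by
        by_contra h
        exact hga (hg a (by simp [hab, h]))
      -- The string with b erased and a reset to X falls under the induction hypothesis; CZ on a, b
      -- adds a Z at b, and rotations at a and b restore the labels of g.
      set g' := Function.update (Function.update g b (false, false)) a (true, false) with hg'
      have hga' : g' a = (true, false) := by simp [hg']
      have hgb' : g' b = (false, false) := by simp [hg', Function.update_of_ne hab.symm]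
      have h1 : IsGenerator S (pauliString g') := by
        refine ih g' fun i hi => ?_
        have hia : i ≠ a := fun h => hi (h ▸ haT)
        rw [hg', Function.update_of_ne hia]
        rcases eq_or_ne i b with rfl | hib
        · simp
        · rw [Function.update_of_ne hib]
          exact hg i (by simp [hib, hi])
      obtain ⟨u, hu, hu'⟩ := hCZ a b hab
      have h2 := h1.conj hu
      rw [hu', Matrix.star_eq_conjTranspose, gateCZ_conjTranspose, pauliString,
        gateCZ_mul_tensor hab _ (by rw [hga']; rfl) (by rw [hgb']; rfl), mul_assoc, gateCZ_sq,
        mul_one] at h2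
      have h3 : IsGenerator S (pauliString (Function.update g' b (false, true))) := by
        rw [pauliString_update]
        exact h2
      have h4 := hchange _ a (g a) (by simp [Function.update_of_ne hab, hga']) hga
        (hchange _ b (g b) (by simp) hgb h3)
      convert h4 using 2
      funext i
      rcases eq_or_ne i a with rfl | hia
      · simp
      rcases eq_or_ne i b with rfl | hib
      · simp [Function.update_of_ne hia]
      · simp [hg', Function.update_of_ne hia, Function.update_of_ne hib]
    · push Not at hT
      have : pauliString g = oneQubit b (pauli (g b)) := by
        rw [pauliString, oneQubit]
        congr 1
        funext i
        rcases eq_or_ne i b with rfl | hib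
        · simp
        · rw [Function.update_of_ne hib, hT i hib]
          rfl
      rw [this]
      exact hG b (g b)

/-- A closed group of unitaries that contains the phases, the Pauli matrices, the gates `H T` and
the products of a controlled-`Z` and a Hadamard gate, is the full unitary group. -/
theorem eq_top_of_gates (hS : IsClosed (S : Set (unitary (Op (Fin n)))))
    (hphase : ∀ z : ℂ, ‖z‖ = 1 → ∃ u ∈ S, (u : Op (Fin n)) = z • 1)
    (hP : ∀ j s, ∃ u ∈ S, (u : Op (Fin n)) = oneQubit j (pauli s))
    (hW : ∀ j, ∃ u ∈ S, (u : Op (Fin n)) = oneQubit j gateHT)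
    (hE : ∀ a b, a ≠ b → ∃ u ∈ S, (u : Op (Fin n)) = gateCZ a b * oneQubit b hadamard) :
    S = ⊤ := by
  have hG : ∀ j s, IsGenerator S (oneQubit j (pauli s)) := fun j s =>
    isGenerator_oneQubit_pauli hS hphase j (hP j) (hW j) s
  have hCZ : ∀ a b, a ≠ b → ∃ u ∈ S, (u : Op (Fin n)) = gateCZ a b := by
    intro a b hab
    have hH : IsGenerator S (oneQubit b hadamard : Op (Fin n)) := by
      rw [hadamard_eq, oneQubit_smul, oneQubit_add]
      have := ((hG b (true, false)).add hS (hG b (false, true))).smul (Real.sqrt 2)⁻¹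
      rwa [Complex.ofReal_inv] at this
    obtain ⟨u, hu, hu'⟩ := hH.smul_I_mem (by rw [oneQubit_mul, hadamard_sq, oneQubit_one])
    obtain ⟨v, hv, hv'⟩ := hE a b hab
    -- The generator H yields only iH as an element of S; this phase removes the factor i.
    obtain ⟨w, hw, hw'⟩ := hphase (-Complex.I) (by simp)
    refine ⟨v * u * w, S.mul_mem (S.mul_mem hv hu) hw, ?_⟩
    simp only [Submonoid.coe_mul, hu', hv', hw']
    rw [mul_smul_comm, mul_one, mul_smul_comm, mul_assoc, oneQubit_mul, hadamard_sq, oneQubit_one,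
      mul_one, smul_smul]
    simp
  refine eq_top_of_isGenerator (fun A => Matrix.finite_spectrum A) fun A hA => ?_
  obtain ⟨d, hd⟩ := exists_eq_real_sum_pauliString (A := A) hA
  rw [hd]
  exact IsGenerator.sum hS _ _ fun f _ => (isGenerator_pauliString hphase hG hCZ f).smul (d f)

end Density

/-! ### Positions of one- and two-qubit observables -/

section Embeddings

variable {Q : Type}

/-- The embedding of a single qubit. -/
def oneEmb (q : Q) : Fin 1 ↪ Q := ⟨fun _ => q, fun _ _ _ => Subsingleton.elim _ _⟩

/-- The embedding of a pair of qubits. -/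
def pairEmb (q r : Q) (h : q ≠ r) : Fin 2 ↪ Q :=
  ⟨![q, r], by
    intro i j hij
    fin_cases i <;> fin_cases j <;> simp_all [eq_comm]⟩

theorem notMem_range_oneEmb {q r : Q} : r ∉ Set.range (oneEmb q) ↔ r ≠ q := by
  simp only [Set.mem_range, not_exists]
  exact ⟨fun h h' => h 0 h'.symm, fun h _ h' => h h'.symm⟩

theorem notMem_range_pairEmb {p q r : Q} (hqr : q ≠ r) :
    p ∉ Set.range (pairEmb q r hqr) ↔ p ≠ q ∧ p ≠ r := by
  simp only [Set.mem_range, not_exists, Fin.forall_fin_two]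
  exact ⟨fun h => ⟨fun h' => h.1 h'.symm, fun h' => h.2 h'.symm⟩,
    fun h => ⟨fun h' => h.1 h'.symm, fun h' => h.2 h'.symm⟩⟩

theorem eq_update_of_forall [DecidableEq Q] {q : Q} {x z : Q → Fin 2} (h : ∀ r, r ≠ q → x r = z r) :
    z = Function.update x q (z q) := by
  funext r
  rcases eq_or_ne r q with rfl | hr
  · simp
  · rw [Function.update_of_ne hr, h r hr]

end Embeddings

/-! ### Post-measurement states in coordinates -/

section Collapse

variable {Q : Type} [Fintype Q] [DecidableEq Q]

/-- The sign of a measurement outcome. -/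
def outcomeSign (b : Bool) : ℂ := if b then 1 else -1

/-- The computational basis state that corresponds to an outcome of a measurement of `Z`. -/
def outcomeBit (b : Bool) : Fin 2 := if b then 0 else 1

/-- Each observable in use is a monomial matrix, with one nonzero entry per row, so an amplitude
after the measurement involves only x and one partner y. -/
theorem halfAdd_actOn_apply {m : ℕ} (A : Op (Fin m)) (e : Fin m ↪ Q) (b : Bool) (ψ : State Q)
    (x y : Q → Fin 2) (hxy : ∀ q, q ∉ Set.range e → x q = y q)
    (h : ∀ z : Q → Fin 2, (∀ q, q ∉ Set.range e → x q = z q) →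
      A (fun i => x (e i)) (fun i => z (e i)) ≠ 0 → z = y) :
    Matrix.toEuclideanLin ((2 : ℂ)⁻¹ • (1 + outcomeSign b • actOn A e)) ψ x
      = 2⁻¹ * (ψ x + outcomeSign b * A (fun i => x (e i)) (fun i => y (e i)) * ψ y) := by
  have h1 : ∑ z, actOn A e x z * ψ z = A (fun i => x (e i)) (fun i => y (e i)) * ψ y := by
    rw [Finset.sum_eq_single y]
    · simp only [actOn, Matrix.of_apply]
      rw [if_pos hxy]
    · intro z _ hz
      simp only [actOn, Matrix.of_apply]
      split_ifs with hc
      · rw [not_not.mp (fun hne => hz (h z hc hne)), zero_mul]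
      · rw [zero_mul]
    · simp
  rw [mul_assoc, ← h1, Matrix.toEuclideanLin, Matrix.toLpLin_apply]
  simp only [Matrix.smul_mulVec, Matrix.add_mulVec, Matrix.one_mulVec, Pi.smul_apply, Pi.add_apply,
    smul_eq_mul]
  rfl

/-- The eigenvalues of `Z`. -/
def bitSign (c : Fin 2) : ℂ := if c = 0 then 1 else -1

/-- The nonzero entries of `(X - Y) / √2`. -/
noncomputable def bitPhase (c : Fin 2) : ℂ :=
  if c = 0 then invSqrtTwo * (1 + Complex.I) else invSqrtTwo * (1 - Complex.I)

theorem collapse_obsZ (q : Q) (b : Bool) (ψ : State Q) (x : Q → Fin 2) :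
    collapse obsZ (oneEmb q) b ψ x = if x q = outcomeBit b then ψ x else 0 := by
  have hm : ∀ c d : Fin 2, tensor ![pauliZ] (fun _ => c) (fun _ => d) = pauliZ c d := by
    intro c d
    simp [tensor]
  refine (halfAdd_actOn_apply (tensor ![pauliZ]) (oneEmb q) b ψ x x (fun _ _ => rfl) ?_).trans ?_
  · intro z hz hne
    have hz' : z = Function.update x q (z q) :=
      eq_update_of_forall fun r h => hz r (notMem_range_oneEmb.mpr h)
    have hne' : pauliZ (x q) (z q) ≠ 0 := by rw [← hm]; exact hne
    have : z q = x q := by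
      generalize z q = d, x q = c at hne' ⊢
      fin_cases c <;> fin_cases d <;> simp [pauliZ] at hne' ⊢
    rw [hz', this, Function.update_eq_self]
  · change 2⁻¹ * (ψ x + outcomeSign b * tensor ![pauliZ] (fun _ => x q) (fun _ => x q) * ψ x) = _
    rw [hm]
    generalize x q = c
    fin_cases c <;> cases b <;> simp [pauliZ, outcomeSign, outcomeBit] <;> ring

theorem collapse_obsXY (q : Q) (b : Bool) (ψ : State Q) (x : Q → Fin 2) :
    collapse obsXY (oneEmb q) b ψ x
      = 2⁻¹ * (ψ x + outcomeSign b * bitPhase (x q) * ψ (Function.update x q (x q + 1))) := by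
  have hm : ∀ c d : Fin 2, tensor ![matXY] (fun _ => c) (fun _ => d) = matXY c d := by
    intro c d
    simp [tensor]
  refine (halfAdd_actOn_apply (tensor ![matXY]) (oneEmb q) b ψ x (Function.update x q (x q + 1))
    (fun r h => by rw [Function.update_of_ne (notMem_range_oneEmb.mp h)]) ?_).trans ?_
  · intro z hz hne
    have hz' : z = Function.update x q (z q) :=
      eq_update_of_forall fun r h => hz r (notMem_range_oneEmb.mpr h)
    have hne' : matXY (x q) (z q) ≠ 0 := by rw [← hm]; exact hne
    have : z q = x q + 1 := by
      generalize z q = d, x q = c at hne' ⊢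
      fin_cases c <;> fin_cases d <;> simp [matXY, pauliX, pauliY] at hne' ⊢
    rw [hz', this]
  · change 2⁻¹ * (ψ x + outcomeSign b * tensor ![matXY] (fun _ => x q)
      (fun _ => Function.update x q (x q + 1) q) * _) = _
    rw [hm, Function.update_self]
    congr 4
    generalize x q = c
    fin_cases c <;> simp [matXY, pauliX, pauliY, bitPhase, invSqrtTwo]

theorem collapse_obsZX {q r : Q} (hqr : q ≠ r) (b : Bool) (ψ : State Q) (x : Q → Fin 2) :
    collapse obsZX (pairEmb q r hqr) b ψ x
      = 2⁻¹ * (ψ x + outcomeSign b * bitSign (x q) * ψ (Function.update x r (x r + 1))) := by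
  have hm : ∀ x z : Q → Fin 2, tensor ![pauliZ, pauliX] (fun i => x (pairEmb q r hqr i))
      (fun i => z (pairEmb q r hqr i)) = pauliZ (x q) (z q) * pauliX (x r) (z r) := by
    intro x z
    rw [tensor, Matrix.of_apply, Fin.prod_univ_two]
    rfl
  refine (halfAdd_actOn_apply (tensor ![pauliZ, pauliX]) (pairEmb q r hqr) b ψ x
    (Function.update x r (x r + 1)) (fun p h => by
      rw [Function.update_of_ne ((notMem_range_pairEmb hqr).mp h).2]) ?_).trans ?_
  · intro z hz hne
    rw [hm] at hne
    have h1 : z q = x q := by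
      have hne := left_ne_zero_of_mul hne
      generalize z q = d, x q = c at hne ⊢
      fin_cases c <;> fin_cases d <;> simp [pauliZ] at hne ⊢
    have h2 : z r = x r + 1 := by
      have hne := right_ne_zero_of_mul hne
      generalize z r = d, x r = c at hne ⊢
      fin_cases c <;> fin_cases d <;> simp [pauliX] at hne ⊢
    rw [← h2]
    refine eq_update_of_forall fun p hp => ?_
    rcases eq_or_ne p q with rfl | hpq
    · exact h1.symm
    · exact hz p ((notMem_range_pairEmb hqr).mpr ⟨hpq, hp⟩)
  · rw [hm, Function.update_self, Function.update_of_ne hqr]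
    congr 4
    generalize x q = c, x r = d
    fin_cases c <;> fin_cases d <;> simp [pauliX, pauliZ, bitSign]

end Collapse

/-! ### Amplitudes relative to the current locations of the qubits -/

section Coefficients

variable {n : ℕ}

/-- The state of the register with the given coefficients, with respect to the locations of the
logical qubits and of the ancillary qubit. -/
noncomputable def spread (π : Equiv.Perm (Fin n ⊕ Fin 1)) (F : (Fin n → Fin 2) → Fin 2 → ℂ) :
    State (Fin n ⊕ Fin 1) :=
  WithLp.toLp 2 fun x => F (fun i => x (π (Sum.inl i))) (x (π (Sum.inr 0)))

theorem spread_apply (π : Equiv.Perm (Fin n ⊕ Fin 1)) (F : (Fin n → Fin 2) → Fin 2 → ℂ)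
    (x : Fin n ⊕ Fin 1 → Fin 2) :
    spread π F x = F (fun i => x (π (Sum.inl i))) (x (π (Sum.inr 0))) := rfl

theorem place_eq_spread (π : Equiv.Perm (Fin n ⊕ Fin 1)) (φ : State (Fin n)) (χ : State (Fin 1)) :
    place π φ χ = spread π fun y c => φ y * χ fun _ => c := by
  ext x
  have h : (fun j : Fin 1 => x (π (Sum.inr j))) = fun _ => x (π (Sum.inr 0)) :=
    funext fun j => by rw [Subsingleton.elim j 0]
  simp only [place, spread, h]

theorem update_comp_inl (π : Equiv.Perm (Fin n ⊕ Fin 1)) (x : Fin n ⊕ Fin 1 → Fin 2) (j : Fin n)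
    (c : Fin 2) : (fun i => Function.update x (π (Sum.inl j)) c (π (Sum.inl i)))
      = Function.update (fun i => x (π (Sum.inl i))) j c := by
  funext i
  rcases eq_or_ne i j with rfl | h
  · simp
  · rw [Function.update_of_ne h, Function.update_of_ne (by simpa using h)]

theorem update_inr_comp_inl (π : Equiv.Perm (Fin n ⊕ Fin 1)) (x : Fin n ⊕ Fin 1 → Fin 2)
    (c : Fin 2) : (fun i => Function.update x (π (Sum.inr 0)) c (π (Sum.inl i)))
      = fun i => x (π (Sum.inl i)) := by
  funext i
  rw [Function.update_of_ne (by simp)]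

theorem update_inl_inr (π : Equiv.Perm (Fin n ⊕ Fin 1)) (x : Fin n ⊕ Fin 1 → Fin 2) (j : Fin n)
    (c : Fin 2) : Function.update x (π (Sum.inl j)) c (π (Sum.inr 0)) = x (π (Sum.inr 0)) :=
  Function.update_of_ne (by simp) _ _

/-- This is the bookkeeping of a transfer: logical qubit j and the ancilla exchange sites. -/
theorem spread_mul_swap (π : Equiv.Perm (Fin n ⊕ Fin 1)) (j : Fin n)
    (F : (Fin n → Fin 2) → Fin 2 → ℂ) :
    spread (π * Equiv.swap (Sum.inl j) (Sum.inr 0)) F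
      = spread π fun y c => F (Function.update y j c) (y j) := by
  ext x
  simp only [spread_apply, Equiv.Perm.mul_apply, Equiv.swap_apply_right]
  congr 1
  funext i
  rcases eq_or_ne i j with rfl | h
  · simp
  · rw [Function.update_of_ne h, Equiv.swap_apply_of_ne_of_ne (by simpa using h) (by simp)]

theorem inl_ne_inr (π : Equiv.Perm (Fin n ⊕ Fin 1)) (j : Fin n) :
    π (Sum.inl j) ≠ π (Sum.inr 0) := by simp

theorem collapse_obsZ_inr (π : Equiv.Perm (Fin n ⊕ Fin 1)) (b : Bool)
    (F : (Fin n → Fin 2) → Fin 2 → ℂ) :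
    collapse obsZ (oneEmb (π (Sum.inr 0))) b (spread π F)
      = spread π fun y c => if c = outcomeBit b then F y c else 0 := by
  ext x
  rw [collapse_obsZ]
  simp only [spread_apply]

theorem collapse_obsZ_inl (π : Equiv.Perm (Fin n ⊕ Fin 1)) (j : Fin n) (b : Bool)
    (F : (Fin n → Fin 2) → Fin 2 → ℂ) :
    collapse obsZ (oneEmb (π (Sum.inl j))) b (spread π F)
      = spread π fun y c => if y j = outcomeBit b then F y c else 0 := by
  ext x
  rw [collapse_obsZ]
  simp only [spread_apply]

theorem collapse_obsXY_inr (π : Equiv.Perm (Fin n ⊕ Fin 1)) (b : Bool)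
    (F : (Fin n → Fin 2) → Fin 2 → ℂ) :
    collapse obsXY (oneEmb (π (Sum.inr 0))) b (spread π F)
      = spread π fun y c => 2⁻¹ * (F y c + outcomeSign b * bitPhase c * F y (c + 1)) := by
  ext x
  rw [collapse_obsXY]
  simp only [spread_apply, update_inr_comp_inl, Function.update_self]

theorem collapse_obsXY_inl (π : Equiv.Perm (Fin n ⊕ Fin 1)) (j : Fin n) (b : Bool)
    (F : (Fin n → Fin 2) → Fin 2 → ℂ) :
    collapse obsXY (oneEmb (π (Sum.inl j))) b (spread π F)
      = spread π fun y c => 2⁻¹ * (F y c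
        + outcomeSign b * bitPhase (y j) * F (Function.update y j (y j + 1)) c) := by
  ext x
  rw [collapse_obsXY]
  simp only [spread_apply, update_comp_inl, update_inl_inr]

theorem collapse_obsZX_inl_inr (π : Equiv.Perm (Fin n ⊕ Fin 1)) (j : Fin n) (b : Bool)
    (F : (Fin n → Fin 2) → Fin 2 → ℂ) :
    collapse obsZX (pairEmb _ _ (inl_ne_inr π j)) b (spread π F)
      = spread π fun y c => 2⁻¹ * (F y c + outcomeSign b * bitSign (y j) * F y (c + 1)) := by
  ext x
  rw [collapse_obsZX]
  simp only [spread_apply, update_inr_comp_inl, Function.update_self]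

theorem collapse_obsZX_inr_inl (π : Equiv.Perm (Fin n ⊕ Fin 1)) (j : Fin n) (b : Bool)
    (F : (Fin n → Fin 2) → Fin 2 → ℂ) :
    collapse obsZX (pairEmb _ _ (inl_ne_inr π j).symm) b (spread π F)
      = spread π fun y c => 2⁻¹ * (F y c
        + outcomeSign b * bitSign c * F (Function.update y j (y j + 1)) c) := by
  ext x
  rw [collapse_obsZX]
  simp only [spread_apply, update_comp_inl, update_inl_inr]

theorem norm_sq_place {k : ℕ} (π : Equiv.Perm (Fin n ⊕ Fin k)) (φ : State (Fin n))
    (χ : State (Fin k)) : ‖place π φ χ‖ ^ 2 = ‖φ‖ ^ 2 * ‖χ‖ ^ 2 := by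
  rw [EuclideanSpace.norm_sq_eq, EuclideanSpace.norm_sq_eq, EuclideanSpace.norm_sq_eq,
    Finset.sum_mul_sum, ← Finset.sum_product', Finset.univ_product_univ]
  refine Fintype.sum_equiv ((Equiv.arrowCongr π.symm (Equiv.refl _)).trans
    (Equiv.sumArrowEquivProdArrow _ _ _)) _ _ fun x => ?_
  simp only [place, norm_mul, mul_pow]
  rfl

theorem norm_sq_ancilla (χ : State (Fin 1)) :
    ‖χ‖ ^ 2 = ‖χ fun _ => 0‖ ^ 2 + ‖χ fun _ => 1‖ ^ 2 := by
  rw [EuclideanSpace.norm_sq_eq, ← Equiv.sum_comp (Equiv.funUnique (Fin 1) (Fin 2)).symm,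
    Fin.sum_univ_two]
  rfl

theorem norm_toEuclideanLin_of_mem_unitaryGroup {K : Op (Fin n)}
    (hK : K ∈ Matrix.unitaryGroup (Fin n → Fin 2) ℂ) (φ : State (Fin n)) :
    ‖Matrix.toEuclideanLin K φ‖ = ‖φ‖ := by
  have h1 : star K * K = 1 := Matrix.mem_unitaryGroup_iff'.mp hK
  have h2 : ‖Matrix.toEuclideanLin K φ‖ ^ 2 = ‖φ‖ ^ 2 := by
    have h3 : inner ℂ (Matrix.toEuclideanLin K φ) (Matrix.toEuclideanLin K φ)
        = inner ℂ φ φ := by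
      rw [← LinearMap.adjoint_inner_right, ← Matrix.toEuclideanLin_conjTranspose_eq_adjoint,
        ← Matrix.star_eq_conjTranspose]
      congr 1
      have := Matrix.toLpLin_mul_same (p := 2) (star K) K
      rw [← LinearMap.comp_apply, Matrix.toEuclideanLin, ← this, h1, Matrix.toLpLin_one]
      rfl
    rw [inner_self_eq_norm_sq_to_K, inner_self_eq_norm_sq_to_K] at h3
    exact_mod_cast h3
  exact (sq_eq_sq₀ (norm_nonneg _) (norm_nonneg _)).mp h2

theorem toEuclideanLin_mul_apply (A B : Op (Fin n)) (φ : State (Fin n)) :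
    Matrix.toEuclideanLin (A * B) φ = Matrix.toEuclideanLin A (Matrix.toEuclideanLin B φ) := by
  rw [Matrix.toEuclideanLin, Matrix.toLpLin_mul_same]
  rfl

theorem oneQubit_apply (j : Fin n) (M : Matrix (Fin 2) (Fin 2) ℂ) (φ : State (Fin n))
    (y : Fin n → Fin 2) : Matrix.toEuclideanLin (oneQubit j M) φ y
      = M (y j) 0 * φ (Function.update y j 0) + M (y j) 1 * φ (Function.update y j 1) := by
  have h0 : ∀ z, oneQubit j M y z = if ∀ i, i ≠ j → y i = z i then M (y j) (z j) else 0 := by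
    intro z
    rw [oneQubit, prod_update_entry]
    simp only [Matrix.one_apply, Finset.prod_ite_zero, Finset.prod_const_one, Finset.mem_erase,
      Finset.mem_univ, and_true, mul_ite, mul_one, mul_zero]
  have h1 : Matrix.toEuclideanLin (oneQubit j M) φ y = ∑ z, oneQubit j M y z * φ z := by
    simp [Matrix.toEuclideanLin, Matrix.toLpLin_apply, Matrix.mulVec, dotProduct]
  have hne : Function.update y j 0 ≠ Function.update y j 1 := fun h => by
    have := congrFun h j
    simp at this
  rw [h1, ← Finset.sum_subset (Finset.subset_univ {Function.update y j 0, Function.update y j 1}),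
    Finset.sum_pair hne, h0, h0, if_pos (fun i hi => by rw [Function.update_of_ne hi]),
    if_pos (fun i hi => by rw [Function.update_of_ne hi]), Function.update_self,
    Function.update_self]
  intro z _ hz
  rw [h0, if_neg, zero_mul]
  intro h
  have hz' : z = Function.update y j (z j) := eq_update_of_forall h
  apply hz
  generalize z j = c at hz'
  rw [hz']
  fin_cases c <;> simp

theorem gateCZ_apply (a b : Fin n) (φ : State (Fin n)) (y : Fin n → Fin 2) :
    Matrix.toEuclideanLin (gateCZ a b) φ y = (if y a = 1 ∧ y b = 1 then -1 else 1) * φ y := by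
  simp [gateCZ, Matrix.toEuclideanLin, Matrix.toLpLin_apply, Matrix.mulVec_diagonal]

end Coefficients

/-! ### Simulation with weights, and the three state transfers -/

section Simulation

variable {n : ℕ}

/-- Some protocol over `F2`, started in the states `f φ χ`, produces `V φ` with probability at least
`w φ χ`. -/
def Achieves (V : Op (Fin n))
    (f : State (Fin n) → State (Fin 1) → State (Fin n ⊕ Fin 1))
    (w : State (Fin n) → State (Fin 1) → ℝ) : Prop :=
  ∃ p : Protocol F2 (Fin n ⊕ Fin 1), ∀ φ χ, w φ χ ≤ p.successProb (f φ χ) ∧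
    p.OnSuccess (fun π ψ => ∃ χ' : State (Fin 1), ψ = place π (Matrix.toEuclideanLin V φ) χ')
      (f φ χ)

/-- The weights are additive over outcomes because states are left unnormalized: squared norms
already carry the probabilities. -/
theorem Achieves.measure {V : Op (Fin n)}
    {f : State (Fin n) → State (Fin 1) → State (Fin n ⊕ Fin 1)}
    {w : Bool → State (Fin n) → State (Fin 1) → ℝ} (A : Observable) (hA : A ∈ F2)
    (e : Fin A.arity ↪ Fin n ⊕ Fin 1)
    (h : ∀ b, Achieves V (fun φ χ => collapse A e b (f φ χ)) (w b)) :
    Achieves V f fun φ χ => w true φ χ + w false φ χ := by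
  choose p hp using h
  refine ⟨.measure A hA e p, fun φ χ => ⟨?_, ?_, ?_⟩⟩
  · exact add_le_add (hp true φ χ).1 (hp false φ χ).1
  · exact (hp true φ χ).2
  · exact (hp false φ χ).2

theorem Achieves.mono {V : Op (Fin n)}
    {f : State (Fin n) → State (Fin 1) → State (Fin n ⊕ Fin 1)}
    {w w' : State (Fin n) → State (Fin 1) → ℝ} (h : Achieves V f w)
    (hw : ∀ φ χ, w' φ χ ≤ w φ χ) : Achieves V f w' := by
  obtain ⟨p, hp⟩ := h
  exact ⟨p, fun φ χ => ⟨(hw φ χ).trans (hp φ χ).1, (hp φ χ).2⟩⟩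

theorem onSuccess_mono {Q : Type} [Fintype Q] [DecidableEq Q] {F : Set Observable}
    {G G' : Equiv.Perm Q → State Q → Prop} (hG : ∀ π ψ, G π ψ → G' π ψ) (p : Protocol F Q) :
    ∀ ψ, p.OnSuccess G ψ → p.OnSuccess G' ψ := by
  induction p with
  | done r =>
    intro ψ h
    cases r with
    | none => trivial
    | some π => exact hG _ _ h
  | measure A hA e next ih => exact fun ψ h => ⟨ih _ _ h.1, ih _ _ h.2⟩

/-- From locations `π`, the operator `V` can be simulated with probability at least `c`. -/
def SimulableAt (V : Op (Fin n)) (π : Equiv.Perm (Fin n ⊕ Fin 1)) (c : ℝ) : Prop :=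
  Achieves V (place π) fun φ χ => c * (‖φ‖ ^ 2 * ‖χ‖ ^ 2)

/-- The scalar is absorbed in the state of the ancilla. This lets Pauli products be handled up to
phase. -/
theorem SimulableAt.smul {V : Op (Fin n)} {π : Equiv.Perm (Fin n ⊕ Fin 1)} {c : ℝ}
    (h : SimulableAt V π c) {z : ℂ} (hz : z ≠ 0) : SimulableAt (z • V) π c := by
  obtain ⟨p, hp⟩ := h
  refine ⟨p, fun φ χ => ⟨(hp φ χ).1, onSuccess_mono ?_ p _ (hp φ χ).2⟩⟩
  rintro π' ψ ⟨χ', rfl⟩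
  refine ⟨z⁻¹ • χ', ?_⟩
  ext x
  simp only [place, map_smul, LinearMap.smul_apply, PiLp.smul_apply, smul_eq_mul]
  field_simp

theorem SimulableAt.of_nonpos (V : Op (Fin n)) (π : Equiv.Perm (Fin n ⊕ Fin 1)) {c : ℝ}
    (hc : c ≤ 0) : SimulableAt V π c :=
  ⟨.done none, fun φ χ => ⟨mul_nonpos_of_nonpos_of_nonneg hc (by positivity), trivial⟩⟩

theorem SimulableAt.one (π : Equiv.Perm (Fin n ⊕ Fin 1)) :
    SimulableAt (1 : Op (Fin n)) π 1 := by
  refine ⟨.done (some π), fun φ χ => ⟨?_, χ, ?_⟩⟩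
  · exact (one_mul _).trans_le (norm_sq_place π φ χ).ge
  · simp [Matrix.toEuclideanLin]

/-- Continue after the measurements have implemented the unitary `K`. -/
theorem SimulableAt.achieves {V' : Op (Fin n)} {π' : Equiv.Perm (Fin n ⊕ Fin 1)} {c : ℝ}
    (h : SimulableAt V' π' c) {V K : Op (Fin n)}
    (hK : K ∈ Matrix.unitaryGroup (Fin n → Fin 2) ℂ) (hV : V' * K = V)
    {f : State (Fin n) → State (Fin 1) → State (Fin n ⊕ Fin 1)}
    {R : State (Fin 1) → State (Fin 1)}
    (hf : ∀ φ χ, f φ χ = place π' (Matrix.toEuclideanLin K φ) (R χ)) :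
    Achieves V f fun φ χ => c * (‖φ‖ ^ 2 * ‖R χ‖ ^ 2) := by
  obtain ⟨p, hp⟩ := h
  refine ⟨p, fun φ χ => ?_⟩
  have := hp (Matrix.toEuclideanLin K φ) (R χ)
  simp only [norm_toEuclideanLin_of_mem_unitaryGroup hK] at this
  rw [← hf, ← toEuclideanLin_mul_apply, hV] at this
  exact this

theorem obsZ_mem_F2 : obsZ ∈ F2 := by simp [F2]

theorem obsZX_mem_F2 : obsZX ∈ F2 := by simp [F2]

theorem obsXY_mem_F2 : obsXY ∈ F2 := by simp [F2]

theorem toEuclideanLin_oneQubit_update (j : Fin n) (M : Matrix (Fin 2) (Fin 2) ℂ)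
    (φ : State (Fin n)) (y : Fin n → Fin 2) (c : Fin 2) :
    Matrix.toEuclideanLin (oneQubit j M) φ (Function.update y j c)
      = M c 0 * φ (Function.update y j 0) + M c 1 * φ (Function.update y j 1) := by
  simp [oneQubit_apply]

/-- A factor of the state of the ancillary qubit. -/
noncomputable def ancilla (v : Fin 2 → ℂ) : State (Fin 1) := WithLp.toLp 2 fun z => v (z 0)

theorem norm_sq_ancilla_mk (v : Fin 2 → ℂ) : ‖ancilla v‖ ^ 2 = ‖v 0‖ ^ 2 + ‖v 1‖ ^ 2 :=
  norm_sq_ancilla _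

theorem norm_invSqrtTwo_sq : ‖invSqrtTwo‖ ^ 2 = 2⁻¹ := by
  rw [← norm_pow, sq, invSqrtTwo_mul_self]
  simp

theorem norm_half_one_add_I_sq : ‖(1 + Complex.I) / 2‖ ^ 2 = 2⁻¹ := by
  rw [← Complex.normSq_eq_norm_sq]
  simp [Complex.normSq_apply]
  norm_num

theorem norm_half_one_sub_I_sq : ‖(1 - Complex.I) / 2‖ ^ 2 = 2⁻¹ := by
  rw [← Complex.normSq_eq_norm_sq]
  simp [Complex.normSq_apply]
  norm_num

theorem norm_outcomeSign (b : Bool) : ‖outcomeSign b‖ = 1 := by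
  cases b <;> simp [outcomeSign]

theorem pauli_mem_unitary (s : Bool × Bool) : pauli s * (pauli s).conjTranspose = 1 := by
  rw [(pauli_hermitian s).eq, pauli_sq]

theorem mul_mul_conjTranspose {M N : Matrix (Fin 2) (Fin 2) ℂ} (hM : M * M.conjTranspose = 1)
    (hN : N * N.conjTranspose = 1) : M * N * (M * N).conjTranspose = 1 := by
  rw [Matrix.conjTranspose_mul, mul_assoc, ← mul_assoc N, hN, one_mul, hM]

theorem fin_two_eq (c : Fin 2) : c = 0 ∨ c = 1 := by omega

/-- The state transfer of the logical qubit `j` to the ancillary qubit, which applies `H T` up to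
Pauli operators. -/
theorem collapse_transferHT (π : Equiv.Perm (Fin n ⊕ Fin 1)) (j : Fin n) (s r t : Bool)
    (φ : State (Fin n)) (χ : State (Fin 1)) :
    collapse obsXY (oneEmb (π (Sum.inl j))) t (collapse obsZX (pairEmb _ _ (inl_ne_inr π j)) r
      (collapse obsZ (oneEmb (π (Sum.inr 0))) s (place π φ χ)))
      = place (π * Equiv.swap (Sum.inl j) (Sum.inr 0))
        (Matrix.toEuclideanLin (oneQubit j (pauli (!s, false) * pauli (false, !r)
          * (gateHT * pauli (false, !t)))) φ)
        (ancilla fun d => 2⁻¹ * (χ fun _ => outcomeBit s) * (if d = 0 then invSqrtTwo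
          else outcomeSign t * ((1 - Complex.I) / 2))) := by
  rw [place_eq_spread, collapse_obsZ_inr, collapse_obsZX_inl_inr, collapse_obsXY_inl,
    place_eq_spread, spread_mul_swap]
  congr 1
  funext y c
  rw [toEuclideanLin_oneQubit_update]
  -- In this form both sides involve only the two amplitudes of φ with bit j set to 0 and 1, and
  -- finitely many cases remain.
  have hy : φ y = φ (Function.update y j (y j)) := by rw [Function.update_eq_self]
  rw [hy]
  clear hy
  simp only [Function.update_self, ancilla]
  have hs := invSqrtTwo_mul_self
  have hI := Complex.I_mul_I
  rcases fin_two_eq (y j) with hd | hd <;> rcases fin_two_eq c with rfl | rfl <;> rw [hd] <;>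
    cases s <;> cases r <;> cases t <;>
    simp [outcomeSign, outcomeBit, bitSign, bitPhase, pauli, pauliX, pauliZ, gateHT,
      Matrix.mul_apply] <;> grind

/-- The converse state transfer of the logical qubit `j` to the ancillary qubit, which applies the
inverse of `H T` up to Pauli operators. -/
theorem collapse_transferInv (π : Equiv.Perm (Fin n ⊕ Fin 1)) (j : Fin n) (t r s : Bool)
    (φ : State (Fin n)) (χ : State (Fin 1)) :
    collapse obsZ (oneEmb (π (Sum.inl j))) s (collapse obsZX (pairEmb _ _ (inl_ne_inr π j).symm) r
      (collapse obsXY (oneEmb (π (Sum.inr 0))) t (place π φ χ)))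
      = place (π * Equiv.swap (Sum.inl j) (Sum.inr 0))
        (Matrix.toEuclideanLin (oneQubit j (gateHT.conjTranspose * (pauli (xor t s, false)
          * pauli (false, !r)))) φ)
        (ancilla fun d => if d = outcomeBit s then (if !r && !s then -1 else 1) * (2⁻¹
          * (invSqrtTwo * (χ fun _ => 0)
            + outcomeSign t * ((1 + Complex.I) / 2) * (χ fun _ => 1))) else 0) := by
  rw [place_eq_spread, collapse_obsXY_inr, collapse_obsZX_inr_inl, collapse_obsZ_inl,
    place_eq_spread, spread_mul_swap]
  congr 1
  funext y c
  rw [toEuclideanLin_oneQubit_update]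
  have hy : φ y = φ (Function.update y j (y j)) := by rw [Function.update_eq_self]
  rw [hy]
  clear hy
  simp only [ancilla]
  have hs := invSqrtTwo_mul_self
  have hI := Complex.I_mul_I
  have h2 : (starRingEnd ℂ) 2 = 2 := map_ofNat _ 2
  rcases fin_two_eq (y j) with hd | hd <;> rcases fin_two_eq c with rfl | rfl <;> rw [hd] <;>
    cases s <;> cases r <;> cases t <;>
    simp [outcomeSign, outcomeBit, bitSign, bitPhase, pauli, pauliX, pauliZ, gateHT, h2,
      Matrix.mul_apply, Matrix.conjTranspose_apply, conj_invSqrtTwo] <;> grind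

set_option maxHeartbeats 2000000 in
/-- The entangling state transfer of the logical qubit `b` to the ancillary qubit. -/
theorem collapse_transferCZ (π : Equiv.Perm (Fin n ⊕ Fin 1)) {a b : Fin n} (hab : a ≠ b)
    (s r u v : Bool) (φ : State (Fin n)) (χ : State (Fin 1)) :
    collapse obsZ (oneEmb (π (Sum.inl b))) v (collapse obsZX (pairEmb _ _ (inl_ne_inr π b).symm) u
      (collapse obsZX (pairEmb _ _ (inl_ne_inr π a)) r
        (collapse obsZ (oneEmb (π (Sum.inr 0))) s (place π φ χ))))
      = place (π * Equiv.swap (Sum.inl b) (Sum.inr 0))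
        (Matrix.toEuclideanLin (oneQubit b (pauli (!s, false)) * (gateCZ a b
          * oneQubit b (pauli (false, xor r v) * hadamard * pauli (false, xor u s)))) φ)
        (ancilla fun d => if d = outcomeBit v then (if xor u s && !v then -1 else 1) * (2⁻¹
          * invSqrtTwo * (χ fun _ => outcomeBit s)) else 0) := by
  rw [place_eq_spread, collapse_obsZ_inr, collapse_obsZX_inl_inr, collapse_obsZX_inr_inl,
    collapse_obsZ_inl, place_eq_spread, spread_mul_swap]
  congr 1
  funext y c
  simp only [toEuclideanLin_mul_apply, toEuclideanLin_oneQubit_update, gateCZ_apply,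
    Function.update_self, Function.update_of_ne hab]
  have hy : φ y = φ (Function.update y b (y b)) := by rw [Function.update_eq_self]
  rw [hy]
  clear hy
  simp only [ancilla]
  have hs := invSqrtTwo_mul_self
  rcases fin_two_eq (y b) with hd | hd <;> rcases fin_two_eq c with rfl | rfl <;>
    rcases fin_two_eq (y a) with ha | ha <;> rw [hd, ha] <;>
    cases s <;> cases r <;> cases u <;> cases v <;>
    simp [outcomeSign, outcomeBit, bitSign, pauli, pauliX, pauliZ, hadamard,
      Matrix.mul_apply] <;> grind

end Simulation

/-! ### Gates that may precede a simulable operator -/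

section Rules

variable {n : ℕ}

theorem gateHT_mul_pauli_Z (t : Bool) :
    gateHT * pauli (false, t) = pauli (t, false) * gateHT := by
  cases t
  · simp [pauli]
  · exact gateHT_mul_pauliZ

theorem hadamard_mul_pauli_Z (t : Bool) :
    hadamard * pauli (false, t) = pauli (t, false) * hadamard := by
  cases t
  · simp [pauli]
  · ext i j
    fin_cases i <;> fin_cases j <;> simp [hadamard, pauli, pauliX, pauliZ]

theorem hadamard_mul_conjTranspose : hadamard * hadamard.conjTranspose = 1 := by
  have h : hadamard.conjTranspose = hadamard := by
    ext i j
    fin_cases i <;> fin_cases j <;> simp [hadamard, conj_invSqrtTwo]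
  rw [h, hadamard_sq]

theorem oneQubit_pauli_sq (j : Fin n) (l : Bool × Bool) :
    oneQubit j (pauli l) * oneQubit j (pauli l) = 1 := by
  rw [oneQubit_mul, pauli_sq, oneQubit_one]

theorem norm_sq_transferHT (k : ℂ) (t : Bool) :
    ‖ancilla fun d => 2⁻¹ * k * (if d = 0 then invSqrtTwo
      else outcomeSign t * ((1 - Complex.I) / 2))‖ ^ 2 = 4⁻¹ * ‖k‖ ^ 2 := by
  rw [norm_sq_ancilla_mk]
  simp only [if_true, one_ne_zero, if_false, norm_mul, mul_pow, norm_invSqrtTwo_sq,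
    norm_outcomeSign, norm_half_one_sub_I_sq]
  norm_num
  ring

theorem norm_sq_ancilla_ite (s b : Bool) (k : ℂ) :
    ‖ancilla fun d => if d = outcomeBit s then (if b then -1 else 1) * k else 0‖ ^ 2
      = ‖k‖ ^ 2 := by
  rw [norm_sq_ancilla_mk]
  cases s <;> cases b <;> simp [outcomeBit]

/-- Simulating `V H T`, given simulations of `V σ` for the Pauli operators `σ`, which occur with
equal probabilities. -/
theorem SimulableAt.mul_gateHT {V : Op (Fin n)} {π : Equiv.Perm (Fin n ⊕ Fin 1)} {j : Fin n}
    {c : ℝ} {c' : Bool × Bool → ℝ}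
    (h : ∀ l, SimulableAt (V * oneQubit j (pauli l))
      (π * Equiv.swap (Sum.inl j) (Sum.inr 0)) (c' l))
    (hc : 4 * c ≤ ∑ l, c' l) : SimulableAt (V * oneQubit j gateHT) π c := by
  -- Moving the last Z past HT turns it into X, so the byproduct is a single Pauli to the left of
  -- HT. For fixed s its label runs once through all four values as r and t vary.
  have hK : ∀ s r t : Bool, ∃ z : ℂ, z ≠ 0 ∧ pauli (!s, false) * pauli (false, !r)
      * (gateHT * pauli (false, !t)) = z • (pauli (xor s t, !r) * gateHT) := by
    intro s r t
    obtain ⟨z, hz, hz'⟩ := pauli_mul (!s, false) (false, !r)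
    obtain ⟨w, hw, hw'⟩ := pauli_mul (pauliAdd (!s, false) (false, !r)) (!t, false)
    refine ⟨z * w, mul_ne_zero hz hw, ?_⟩
    have : pauliAdd (pauliAdd (!s, false) (false, !r)) (!t, false) = (xor s t, !r) := by
      simp [pauliAdd]
    rw [gateHT_mul_pauli_Z, ← mul_assoc, hz', Matrix.smul_mul, hw', this, smul_smul,
      Matrix.smul_mul]
  choose z hz hz' using hK
  have leaf := fun s r t => ((h (xor s t, !r)).smul (inv_ne_zero (hz s r t))).achieves
    (V := V * oneQubit j gateHT)
    (oneQubit_mem_unitaryGroup j (mul_mul_conjTranspose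
      (mul_mul_conjTranspose (pauli_mem_unitary (!s, false)) (pauli_mem_unitary (false, !r)))
      (mul_mul_conjTranspose gateHT_mul_conjTranspose (pauli_mem_unitary (false, !t)))))
    (by
      rw [hz', oneQubit_smul, smul_mul_smul_comm, inv_mul_cancel₀ (hz s r t), one_smul,
        ← oneQubit_mul, mul_assoc, ← mul_assoc (oneQubit j (pauli _)), oneQubit_pauli_sq, one_mul])
    (fun φ χ => collapse_transferHT π j s r t φ χ)
  refine (Achieves.measure obsZ obsZ_mem_F2 (oneEmb (π (Sum.inr 0))) fun s =>
    Achieves.measure obsZX obsZX_mem_F2 (pairEmb _ _ (inl_ne_inr π j)) fun r =>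
    Achieves.measure obsXY obsXY_mem_F2 (oneEmb (π (Sum.inl j))) fun t => leaf s r t).mono
      fun φ χ => ?_
  -- Given s, every pair (r, t) has the same weight 1/4, independently of the states; this is the
  -- uniformity that the random walk needs.
  simp only [norm_sq_transferHT, norm_sq_ancilla χ]
  simp only [outcomeBit, if_true, Bool.not_true, Bool.not_false, Bool.xor_true, Bool.xor_false,
    Bool.false_eq_true, if_false]
  have := mul_le_mul_of_nonneg_right hc
    (by positivity : 0 ≤ 4⁻¹ * ‖φ‖ ^ 2 * (‖χ fun _ => 0‖ ^ 2 + ‖χ fun _ => 1‖ ^ 2))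
  simp only [Fintype.sum_prod_type, Fintype.sum_bool] at this
  linarith

/-- Simulating `V`, given simulations of `V σ H T` for the Pauli operators `σ`. -/
theorem SimulableAt.of_mul_pauli_mul_gateHT {V : Op (Fin n)} {π : Equiv.Perm (Fin n ⊕ Fin 1)}
    {j : Fin n} {c : ℝ}
    (h : ∀ l, SimulableAt (V * oneQubit j (pauli l) * oneQubit j gateHT)
      (π * Equiv.swap (Sum.inl j) (Sum.inr 0)) c) : SimulableAt V π c := by
  have hK : ∀ t r s : Bool, ∃ z : ℂ, z ≠ 0 ∧ pauli (xor t s, false) * pauli (false, !r)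
      = z • pauli (xor t s, !r) := by
    intro t r s
    obtain ⟨z, hz, hz'⟩ := pauli_mul (xor t s, false) (false, !r)
    exact ⟨z, hz, by simpa [pauliAdd] using hz'⟩
  choose z hz hz' using hK
  have leaf := fun t r s => ((h (xor t s, !r)).smul (inv_ne_zero (hz t r s))).achieves (V := V)
    (oneQubit_mem_unitaryGroup j (mul_mul_conjTranspose
      (M := gateHT.conjTranspose) (by rw [Matrix.conjTranspose_conjTranspose,
        conjTranspose_gateHT_mul])
      (mul_mul_conjTranspose (pauli_mem_unitary (xor t s, false)) (pauli_mem_unitary (false, !r)))))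
    (by
      rw [hz', Matrix.mul_smul, oneQubit_smul, smul_mul_smul_comm, inv_mul_cancel₀ (hz t r s),
        one_smul, ← oneQubit_mul, mul_assoc, ← mul_assoc (oneQubit j gateHT), oneQubit_mul j gateHT,
        gateHT_mul_conjTranspose, oneQubit_one, one_mul, mul_assoc, oneQubit_pauli_sq, mul_one])
    (fun φ χ => collapse_transferInv π j t r s φ χ)
  refine (Achieves.measure obsXY obsXY_mem_F2 (oneEmb (π (Sum.inr 0))) fun t =>
    Achieves.measure obsZX obsZX_mem_F2 (pairEmb _ _ (inl_ne_inr π j).symm) fun r =>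
    Achieves.measure obsZ obsZ_mem_F2 (oneEmb (π (Sum.inl j))) fun s => leaf t r s).mono
      fun φ χ => le_of_eq ?_
  simp only [norm_sq_ancilla_ite, norm_sq_ancilla χ]
  simp only [outcomeSign, if_true, Bool.false_eq_true, if_false]
  -- Here the outcome t of the first measurement may be biased by χ, but all branches have the same
  -- bound c, so only the total weight counts.
  have h1 := parallelogram_law_with_norm ℂ (invSqrtTwo * (χ fun _ => 0))
    ((1 + Complex.I) / 2 * (χ fun _ => 1))
  have h2 : ‖invSqrtTwo * (χ fun _ => 0)‖ ^ 2 = 2⁻¹ * ‖χ fun _ => 0‖ ^ 2 := by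
    rw [norm_mul, mul_pow, norm_invSqrtTwo_sq]
  have h3 : ‖(1 + Complex.I) / 2 * (χ fun _ => 1)‖ ^ 2 = 2⁻¹ * ‖χ fun _ => 1‖ ^ 2 := by
    rw [norm_mul, mul_pow, norm_half_one_add_I_sq]
  rw [h2, h3] at h1
  have h4 : ∀ x : ℂ, ‖2⁻¹ * x‖ ^ 2 = 4⁻¹ * ‖x‖ ^ 2 := by
    intro x
    rw [norm_mul, mul_pow]
    norm_num
  simp only [h4, one_mul, neg_mul, ← sub_eq_add_neg]
  linear_combination (-(c * ‖φ‖ ^ 2)) * h1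

theorem gateCZ_comm (a b : Fin n) : gateCZ a b = gateCZ b a := by
  simp only [gateCZ, and_comm]

theorem gateCZ_mul_oneQubit_pauli_Z (a b : Fin n) (t : Bool) :
    gateCZ a b * oneQubit b (pauli (false, t)) = oneQubit b (pauli (false, t)) * gateCZ a b := by
  cases t
  · simp [pauli, oneQubit_one]
  ext x y
  rw [gateCZ, Matrix.diagonal_mul, Matrix.mul_diagonal]
  by_cases hxy : x = y
  · rw [hxy, mul_comm]
  · have h0 : oneQubit b (pauli (false, true)) x y = 0 := by
      obtain ⟨i, hi⟩ := Function.ne_iff.mp hxy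
      rw [oneQubit, tensor, Matrix.of_apply]
      refine Finset.prod_eq_zero (Finset.mem_univ i) ?_
      rcases eq_or_ne i b with rfl | hib
      · rw [Function.update_self]
        generalize x i = c, y i = d at hi
        fin_cases c <;> fin_cases d <;> simp [pauli, pauliZ] at hi ⊢
      · rw [Function.update_of_ne hib, Matrix.one_apply_ne hi]
    rw [h0, mul_zero, zero_mul]

theorem gateCZ_mul_oneQubit_pauli_X {a b : Fin n} (hab : a ≠ b) (t : Bool) :
    gateCZ a b * oneQubit b (pauli (t, false))
      = oneQubit a (pauli (false, t)) * oneQubit b (pauli (t, false)) * gateCZ a b := by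
  cases t
  · simp [pauli, oneQubit_one]
  rw [gateCZ_comm, oneQubit.eq_1 b, gateCZ_mul_tensor hab.symm _ (by simp [pauli])
    (by rw [Function.update_of_ne hab]), oneQubit_mul_tensor, Function.update_of_ne hab, mul_one]
  rfl

/-- `V` can be simulated from all locations, with probability arbitrarily close to one. -/
def Simulable (V : Op (Fin n)) : Prop := ∀ π, ∀ ε : ℝ, 0 < ε → SimulableAt V π (1 - ε)

theorem Simulable.smul {V : Op (Fin n)} (h : Simulable V) {z : ℂ} (hz : z ≠ 0) :
    Simulable (z • V) := fun π ε hε => (h π ε hε).smul hz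

theorem simulable_one : Simulable (1 : Op (Fin n)) := by
  intro π ε hε
  refine (SimulableAt.one π).mono fun φ χ => ?_
  have : 0 ≤ ‖φ‖ ^ 2 * ‖χ‖ ^ 2 := by positivity
  nlinarith

/-- One round is an inverse transfer followed by a forward one. With probability 1/4 the combined
Pauli is the required one and only V remains; otherwise the induction hypothesis handles the Pauli
still owed. The failure bound is multiplied by 3/4. -/
theorem simulableAt_mul_pauli {V : Op (Fin n)} (hV : Simulable V) (j : Fin n) {ε : ℝ} (hε : 0 < ε)
    (m : ℕ) : ∀ (l : Bool × Bool) (π : Equiv.Perm (Fin n ⊕ Fin 1)),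
      SimulableAt (V * oneQubit j (pauli l)) π (1 - (3 / 4) ^ m - ε) := by
  induction m with
  -- With no rounds left the bound is -ε, met by announcing failure.
  | zero => exact fun l π => .of_nonpos _ _ (by linarith [pow_zero (3 / 4 : ℝ)])
  | succ m ih =>
    intro l π
    refine SimulableAt.of_mul_pauli_mul_gateHT (j := j) fun l' => ?_
    obtain ⟨z, hz, hz'⟩ := pauli_mul l l'
    rw [mul_assoc V, oneQubit_mul, hz', oneQubit_smul, Matrix.mul_smul, Matrix.smul_mul]
    refine SimulableAt.smul ?_ hz
    generalize pauliAdd l l' = L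
    refine SimulableAt.mul_gateHT
      -- The average over the four labels is exact: (1 - ε) + 3(1 - (3/4)^m - ε) = 4(1 - (3/4)^(m+1)
      -- - ε).
      (c' := fun l'' => if l'' = L then 1 - ε else 1 - (3 / 4) ^ m - ε) (fun l'' => ?_) ?_
    · split_ifs with heq
      · rw [heq, mul_assoc, oneQubit_pauli_sq, mul_one]
        exact hV _ ε hε
      · obtain ⟨w, hw, hw'⟩ := pauli_mul L l''
        rw [mul_assoc, oneQubit_mul, hw', oneQubit_smul, Matrix.mul_smul]
        exact (ih _ _).smul hw
    · rcases L with ⟨_ | _, _ | _⟩ <;> simp [Fintype.sum_prod_type] <;> ring_nf <;> rfl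

theorem Simulable.mul_pauli {V : Op (Fin n)} (hV : Simulable V) (j : Fin n) (l : Bool × Bool) :
    Simulable (V * oneQubit j (pauli l)) := by
  intro π ε hε
  obtain ⟨m, hm⟩ := exists_pow_lt_of_lt_one (half_pos hε) (by norm_num : (3 / 4 : ℝ) < 1)
  refine (simulableAt_mul_pauli hV j (half_pos hε) m l π).mono fun φ χ => ?_
  exact mul_le_mul_of_nonneg_right (by linarith) (by positivity)

theorem Simulable.mul_gateHT {V : Op (Fin n)} (hV : Simulable V) (j : Fin n) :
    Simulable (V * oneQubit j gateHT) := fun π ε hε =>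
  SimulableAt.mul_gateHT (c' := fun _ => 1 - ε) (fun l => hV.mul_pauli j l _ ε hε)
    (by simp; linarith)

/-- All byproducts can be pushed to the left of CZ·H, where the Pauli rule removes them; an X on b
passing CZ leaves an additional Z on a. -/
theorem Simulable.mul_gateCZ_hadamard {V : Op (Fin n)} (hV : Simulable V) {a b : Fin n}
    (hab : a ≠ b) : Simulable (V * (gateCZ a b * oneQubit b hadamard)) := by
  intro π ε hε
  have leaf := fun s r u v => ((((((hV.mul_pauli a (false, xor u s)).mul_pauli b
    (xor u s, false)).mul_pauli b (false, xor r v)).mul_pauli b (!s, false))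
    (π * Equiv.swap (Sum.inl b) (Sum.inr 0)) ε hε)).achieves
    (V := V * (gateCZ a b * oneQubit b hadamard))
    (mul_mem (oneQubit_mem_unitaryGroup b (pauli_mem_unitary (!s, false)))
      (mul_mem (gateCZ_mem_unitaryGroup a b) (oneQubit_mem_unitaryGroup b
        (mul_mul_conjTranspose (mul_mul_conjTranspose (pauli_mem_unitary (false, xor r v))
          hadamard_mul_conjTranspose) (pauli_mem_unitary (false, xor u s))))))
    (by
      generalize xor u s = w, xor r v = x
      have e1 : ∀ (l : Bool × Bool) (B : Op (Fin n)),
          oneQubit b (pauli l) * (oneQubit b (pauli l) * B) = B := fun l B => by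
        rw [← mul_assoc, oneQubit_pauli_sq, one_mul]
      have e2 : oneQubit b (pauli (false, x)) * (gateCZ a b
          * oneQubit b (pauli (false, x) * hadamard * pauli (false, w)))
          = gateCZ a b * (oneQubit b (pauli (w, false)) * oneQubit b hadamard) := by
        rw [← mul_assoc, ← gateCZ_mul_oneQubit_pauli_Z, mul_assoc, oneQubit_mul,
          mul_assoc (pauli _) hadamard, ← mul_assoc (pauli _), pauli_sq, one_mul,
          hadamard_mul_pauli_Z, oneQubit_mul]
      have e3 : oneQubit a (pauli (false, w)) * (oneQubit b (pauli (w, false))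
          * (gateCZ a b * (oneQubit b (pauli (w, false)) * oneQubit b hadamard)))
          = gateCZ a b * oneQubit b hadamard := by
        have := gateCZ_mul_oneQubit_pauli_X hab w
        rw [← mul_assoc, ← mul_assoc, ← this, mul_assoc, e1]
      rw [mul_assoc, e1, mul_assoc, e2, mul_assoc, mul_assoc, e3])
    (fun φ χ => collapse_transferCZ π hab s r u v φ χ)
  refine (Achieves.measure obsZ obsZ_mem_F2 (oneEmb (π (Sum.inr 0))) fun s =>
    Achieves.measure obsZX obsZX_mem_F2 (pairEmb _ _ (inl_ne_inr π a)) fun r =>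
    Achieves.measure obsZX obsZX_mem_F2 (pairEmb _ _ (inl_ne_inr π b).symm) fun u =>
    Achieves.measure obsZ obsZ_mem_F2 (oneEmb (π (Sum.inl b))) fun v => leaf s r u v).mono
      fun φ χ => le_of_eq ?_
  simp only [norm_sq_ancilla_ite, norm_sq_ancilla χ]
  simp only [outcomeBit, if_true, Bool.false_eq_true, if_false, norm_mul, mul_pow,
    norm_invSqrtTwo_sq, norm_inv, Complex.norm_ofNat]
  ring

end Rules

/-! ### Approximate universality with one ancilla -/

section Universality

open scoped Matrix.Norms.L2Operator

variable {n : ℕ}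

/-- The unitaries by which a simulation can be preceded. -/
def prefixable (n : ℕ) : Submonoid (unitary (Op (Fin n))) where
  carrier := {u | ∀ V : Op (Fin n), Simulable V → Simulable (V * (u : Op (Fin n)))}
  mul_mem' := fun {u v} hu hv V hV => by
    rw [Submonoid.coe_mul, ← mul_assoc]
    exact hv _ (hu _ hV)
  one_mem' := fun V hV => by simpa using hV

theorem compactSpace_unitary : CompactSpace (unitary (Op (Fin n))) := by
  have h : IsCompact (unitary (Op (Fin n)) : Set (Op (Fin n))) := by
    refine Metric.isCompact_of_isClosed_isBounded isClosed_unitary ?_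
    refine (Metric.isBounded_closedBall (x := (0 : Op (Fin n))) (r := 1)).subset fun u hu => ?_
    rw [mem_closedBall_zero_iff]
    exact (CStarRing.norm_of_mem_unitary hu).le
  exact isCompact_iff_compactSpace.mp h

/-- Only products of the available gates are simulable a priori, not inverses. In a compact group
this is no loss: the closure of a submonoid is already a group, so the density result for closed
groups applies. -/
theorem closure_prefixable : closure (prefixable n : Set (unitary (Op (Fin n)))) = Set.univ := by
  have : CompactSpace (unitary (Op (Fin n))) := compactSpace_unitary
  have h1 := topologicalClosure_subgroupClosure_toSubmonoid
    (prefixable n : Set (unitary (Op (Fin n))))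
  set S := (Subgroup.closure (prefixable n : Set (unitary (Op (Fin n))))).topologicalClosure
    with hS
  have hmem : ∀ A : Op (Fin n), A ∈ Matrix.unitaryGroup (Fin n → Fin 2) ℂ →
      (∀ V, Simulable V → Simulable (V * A)) → ∃ u ∈ S, (u : Op (Fin n)) = A := fun A hA h =>
    ⟨⟨A, hA⟩, Subgroup.le_topologicalClosure _ (Subgroup.subset_closure h), rfl⟩
  have htop : S = ⊤ := by
    refine eq_top_of_gates (Subgroup.isClosed_topologicalClosure _) (fun z hz => ?_)
      (fun j s => hmem _ (oneQubit_mem_unitaryGroup j (pauli_mem_unitary s))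
        fun V hV => hV.mul_pauli j s)
      (fun j => hmem _ (oneQubit_mem_unitaryGroup j gateHT_mul_conjTranspose)
        fun V hV => hV.mul_gateHT j)
      (fun a b hab => hmem _ (mul_mem (gateCZ_mem_unitaryGroup a b)
        (oneQubit_mem_unitaryGroup b ?_)) fun V hV => hV.mul_gateCZ_hadamard hab)
    · have hz0 : z ≠ 0 := by
        rintro rfl
        simp at hz
      refine hmem _ ?_ fun V hV => by
        rw [Matrix.mul_smul, mul_one]
        exact hV.smul hz0
      rw [Matrix.mem_unitaryGroup_iff, star_smul, star_one, smul_mul_smul_comm, mul_one,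
        Complex.star_def, Complex.mul_conj, Complex.normSq_eq_norm_sq, hz]
      simp
    · exact hadamard_mul_conjTranspose
  have h2 : ((Subgroup.closure (prefixable n : Set (unitary (Op (Fin n))))).topologicalClosure
      : Set (unitary (Op (Fin n)))) = closure (prefixable n : Set (unitary (Op (Fin n)))) := by
    rw [Submonoid.closure_eq] at h1
    exact congrArg (fun T : Submonoid (unitary (Op (Fin n))) => (T : Set (unitary (Op (Fin n))))) h1
  rw [← h2, ← hS, htop]
  rfl

theorem approxUniversal_F2 : ApproxUniversal F2 1 := by
  intro n U hU ε hε δ hδ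
  have hmem : (⟨U, hU⟩ : unitary (Op (Fin n))) ∈ closure (prefixable n : Set _) := by
    rw [closure_prefixable]
    trivial
  obtain ⟨V, hV, hd⟩ := Metric.mem_closure_iff.mp hmem δ hδ
  refine ⟨V, V.2, ?_, ?_⟩
  · rw [Subtype.dist_eq, dist_eq_norm] at hd
    exact hd
  · have hsim : Simulable (V : Op (Fin n)) := by simpa using hV 1 simulable_one
    obtain ⟨p, hp⟩ := hsim 1 (ε / 2) (half_pos hε)
    refine ⟨p, fun φ χ hφ hχ => ⟨lt_of_lt_of_le ?_ (hp φ χ).1, (hp φ χ).2⟩⟩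
    simp only [hφ, hχ]
    linarith

end Universality

/-! ### Impossibility without ancillary qubits -/

section NoAncilla

variable {Q : Type} [Fintype Q] [DecidableEq Q]

theorem actOn_mul {m : ℕ} (A B : Op (Fin m)) (e : Fin m ↪ Q) :
    actOn A e * actOn B e = actOn (A * B) e := by
  ext x z
  simp only [Matrix.mul_apply, actOn, Matrix.of_apply]
  by_cases hxz : ∀ q, q ∉ Set.range e → x q = z q
  · rw [if_pos hxz]
    symm
    refine Fintype.sum_of_injective (fun w : Fin m → Fin 2 => Function.extend e w x)
      (Function.extend_injective e.injective x) _ _ (fun y hy => ?_) fun w => ?_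
    · rw [if_neg, zero_mul]
      intro h
      refine hy ⟨fun i => y (e i), ?_⟩
      funext q
      by_cases hq : ∃ i, e i = q
      · obtain ⟨i, rfl⟩ := hq
        exact e.injective.extend_apply _ _ i
      · exact (Function.extend_apply' _ _ _ hq).trans (h q hq)
    · have h1 : ∀ q, q ∉ Set.range e → Function.extend e w x q = x q :=
        fun q hq => Function.extend_apply' _ _ _ hq
      have h2 : (fun i => Function.extend e w x (e i)) = w :=
        funext fun i => e.injective.extend_apply _ _ i
      rw [if_pos fun q hq => (h1 q hq).symm, if_pos fun q hq => (h1 q hq).trans (hxz q hq), h2]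
  · rw [if_neg hxz]
    refine Finset.sum_eq_zero fun y _ => ?_
    by_cases h1 : ∀ q, q ∉ Set.range e → x q = y q
    · rw [if_neg (c := ∀ q, q ∉ Set.range e → y q = z q)
        (fun h2 => hxz fun q hq => (h1 q hq).trans (h2 q hq)), mul_zero]
    · rw [if_neg h1, zero_mul]

theorem actOn_one {m : ℕ} (e : Fin m ↪ Q) : actOn (1 : Op (Fin m)) e = 1 := by
  ext x z
  simp only [actOn, Matrix.of_apply, Matrix.one_apply]
  by_cases hxz : x = z
  · simp [hxz]
  · rw [if_neg hxz]
    split_ifs with h1 h2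
    · exfalso
      refine hxz (funext fun q => ?_)
      by_cases hq : q ∈ Set.range e
      · obtain ⟨i, rfl⟩ := hq
        exact congrFun h2 i
      · exact h1 q hq
    · rfl
    · rfl

theorem eq_smul_one_of_actOn {m : ℕ} {A : Op (Fin m)} {e : Fin m ↪ Q} {z : ℂ}
    (h : actOn A e = z • 1) : A = z • 1 := by
  ext a b
  have h1 := congrFun (congrFun h (Function.extend e a 0)) (Function.extend e b 0)
  have h2 : ∀ w : Fin m → Fin 2, (fun i => Function.extend e w 0 (e i)) = w :=
    fun w => funext fun i => e.injective.extend_apply _ _ i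
  rw [actOn, Matrix.of_apply, if_pos, h2, h2] at h1
  · rw [h1]
    simp only [Matrix.smul_apply, Matrix.one_apply,
      (Function.extend_injective e.injective (0 : Q → Fin 2)).eq_iff]
  · intro q hq
    rw [Function.extend_apply' _ _ _ hq, Function.extend_apply' _ _ _ hq]

/-- A measurement of a nontrivial observable annihilates some state, for each outcome. -/
theorem exists_collapse_eq_zero {A : Observable} (hA : ∀ z : ℂ, A.mat ≠ z • 1)
    (e : Fin A.arity ↪ Q) (b : Bool) : ∃ u : State Q, u ≠ 0 ∧ collapse A e b u = 0 := by
  set s : ℂ := if b then 1 else -1 with hs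
  have hss : s * s = 1 := by cases b <;> simp [hs]
  -- The projector is (1 + sA)/2, and (1 + sA)(1 - sA) = 0; so it kills the range of N, which is
  -- nonzero because A is not the scalar s.
  set N : Op Q := 1 - s • actOn A.mat e with hN
  have hN0 : N ≠ 0 := by
    intro h
    refine hA s (eq_smul_one_of_actOn (e := e) ?_)
    rw [sub_eq_zero.mp h, smul_smul, hss, one_smul]
  have hPN : projector A e b * N = 0 := by
    have hM : actOn A.mat e * actOn A.mat e = 1 := by
      rw [actOn_mul, A.involutive, actOn_one]
    rw [projector, ← hs, hN, Matrix.smul_mul, mul_sub, mul_one, add_mul, one_mul,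
      smul_mul_smul_comm, hM, hss, one_smul, add_comm 1, sub_self, smul_zero]
  have hlin : Matrix.toEuclideanLin N ≠ 0 := by
    simpa using hN0
  obtain ⟨x, hx⟩ : ∃ x, Matrix.toEuclideanLin N x ≠ 0 := by
    by_contra! h
    exact hlin (LinearMap.ext h)
  refine ⟨_, hx, ?_⟩
  have h3 : Matrix.toEuclideanLin (projector A e b * N) x = 0 := by rw [hPN]; simp
  rw [Matrix.toEuclideanLin, Matrix.toLpLin_mul_same] at h3
  exact h3

/-- A fixed branch of the tree acts linearly. One reached with success from ψ gives a K that is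
nonzero at ψ, while its correctness condition holds for every input, even one that makes the branch
improbable. -/
theorem exists_linear_of_successProb_ne_zero {F : Set Observable} (p : Protocol F Q) :
    ∀ ψ : State Q, p.successProb ψ ≠ 0 → ∃ (K : State Q →ₗ[ℂ] State Q) (π : Equiv.Perm Q),
      K ψ ≠ 0 ∧ ∀ G ψ', p.OnSuccess G ψ' → G π (K ψ') := by
  induction p with
  | done r =>
    intro ψ h
    cases r with
    | none => exact absurd rfl h
    | some π =>
      refine ⟨LinearMap.id, π, fun h0 => h ?_, fun G ψ' h' => h'⟩
      have h0' : ψ = 0 := h0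
      simp [Protocol.successProb, h0']
  | measure A hA e next ih =>
    intro ψ h
    have hb : ∃ b, (next b).successProb (collapse A e b ψ) ≠ 0 := by
      by_contra! h'
      exact h (by simp [Protocol.successProb, h'])
    obtain ⟨b, hb⟩ := hb
    obtain ⟨K, π, hK, hG⟩ := ih b _ hb
    refine ⟨K ∘ₗ Matrix.toEuclideanLin (projector A e b), π, hK, fun G ψ' h' => hG G _ ?_⟩
    cases b
    · exact h'.2
    · exact h'.1

/-- Without ancillary qubits, a protocol that starts with a measurement does not act injectively. -/
theorem not_simulates_measure {F : Set Observable} {A : Observable} (hA : A ∈ F)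
    (hA' : ∀ z : ℂ, A.mat ≠ z • 1) (e : Fin A.arity ↪ Q) (next : Bool → Protocol F Q)
    (L : Equiv.Perm Q → State Q →ₗ[ℂ] State Q) (hL : ∀ π, Function.Injective (L π))
    (h : ∀ ψ : State Q, ‖ψ‖ = 1 → (Protocol.measure A hA e next).successProb ψ ≠ 0 ∧
      (Protocol.measure A hA e next).OnSuccess (fun π ψ' => ∃ c : ℂ, ψ' = c • L π ψ) ψ) :
    False := by
  -- The hypothesis concerns unit vectors only; the normalizing factor is moved into the free scalar
  -- c.
  have hhom : ∀ ψ : State Q, ψ ≠ 0 → ∀ b, (next b).OnSuccess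
      (fun π ψ' => ∃ c : ℂ, ψ' = c • L π ψ) (collapse A e b (((‖ψ‖ : ℂ)⁻¹) • ψ)) := by
    intro ψ hψ b
    have h1 := (h (((‖ψ‖ : ℂ)⁻¹) • ψ) (norm_smul_inv_norm hψ)).2
    have h2 : (next b).OnSuccess (fun π ψ' => ∃ c : ℂ, ψ' = c • L π (((‖ψ‖ : ℂ)⁻¹) • ψ))
        (collapse A e b (((‖ψ‖ : ℂ)⁻¹) • ψ)) := by
      cases b
      · exact h1.2
      · exact h1.1
    refine onSuccess_mono ?_ _ _ h2
    rintro π ψ' ⟨c, rfl⟩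
    exact ⟨c * (‖ψ‖ : ℂ)⁻¹, by rw [map_smul, smul_smul]⟩
  obtain ⟨ψ, hψ⟩ : ∃ ψ : State Q, ‖ψ‖ = 1 :=
    ⟨EuclideanSpace.single 0 1, by simp⟩
  have hψ0 : ψ ≠ 0 := by
    rintro rfl
    simp at hψ
  obtain ⟨b, hb⟩ : ∃ b, (next b).successProb (collapse A e b ψ) ≠ 0 := by
    by_contra! h'
    exact (h ψ hψ).1 (by simp [Protocol.successProb, h'])
  obtain ⟨K, π, hK, hG⟩ := exists_linear_of_successProb_ne_zero _ _ hb
  obtain ⟨u, hu, hu0⟩ := exists_collapse_eq_zero hA' e b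
  have hlin : ∀ (z : ℂ) (v : State Q), collapse A e b (z • v) = z • collapse A e b v :=
    fun z v => map_smul _ _ _
  -- After outcome b the inputs ψ and ψ + u are indistinguishable, so by injectivity of L they must
  -- be proportional; collapsing shows that the factor is 1, whence u = 0.
  have hadd : collapse A e b (ψ + u) = collapse A e b ψ := by
    have : collapse A e b (ψ + u) = collapse A e b ψ + collapse A e b u := map_add _ _ _
    rw [this, hu0, add_zero]
  have key : ∀ v : State Q, v ≠ 0 → collapse A e b v = collapse A e b ψ →
      ∃ c : ℂ, K (collapse A e b ψ) = L π (c • v) := by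
    intro v hv hvψ
    obtain ⟨c, hc⟩ := hG _ _ (hhom v hv b)
    rw [hlin, hvψ, map_smul] at hc
    refine ⟨(‖v‖ : ℂ) * c, ?_⟩
    have hn : (‖v‖ : ℂ) ≠ 0 := by exact_mod_cast norm_ne_zero_iff.mpr hv
    rw [map_smul, mul_smul, ← hc, smul_smul, mul_inv_cancel₀ hn, one_smul]
  have hψu : ψ + u ≠ 0 := by
    intro h0
    rw [h0] at hadd
    have : collapse A e b (0 : State Q) = 0 := map_zero _
    rw [← hadd, this, map_zero] at hK
    exact hK rfl
  obtain ⟨c, hc⟩ := key ψ hψ0 rfl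
  obtain ⟨d, hd⟩ := key (ψ + u) hψu hadd
  have heq : c • ψ = d • (ψ + u) := hL π (hc.symm.trans hd)
  have hcol := congrArg (collapse A e b) heq
  rw [hlin, hlin, hadd] at hcol
  have hP0 : collapse A e b ψ ≠ 0 := by
    intro h0
    rw [h0, map_zero] at hK
    exact hK rfl
  have hcd : c = d := smul_left_injective ℂ hP0 hcol
  have hd0 : d ≠ 0 := by
    rintro rfl
    rw [zero_smul, map_zero] at hd
    exact hK hd
  rw [hcd, smul_add, left_eq_add, smul_eq_zero] at heq
  exact heq.elim hd0 hu

theorem mat_ne_smul_one {A : Observable} (hA : A ∈ F1) (z : ℂ) : A.mat ≠ z • 1 := by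
  have h01 : ((fun _ => 0) : Fin 1 → Fin 2) ≠ fun _ => 1 := fun h => by
    have := congrFun h 0
    simp at this
  have hoff : (z • (1 : Op (Fin 1))) (fun _ => 0) (fun _ => 1) = 0 := by
    rw [Matrix.smul_apply, Matrix.one_apply_ne h01, smul_zero]
  have hdiag : ∀ a, (z • (1 : Op (Fin 1))) a a = z := fun a => by
    rw [Matrix.smul_apply, Matrix.one_apply_eq, smul_eq_mul, mul_one]
  rcases hA with rfl | rfl | rfl | rfl
  · intro h
    have h1 := congrFun (congrFun h ![0, 0]) ![0, 1]
    have h2 : (![0, 0] : Fin 2 → Fin 2) ≠ ![0, 1] := by decide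
    have h3 : obsZX.mat ![0, 0] ![0, 1] = 1 := by
      change tensor ![pauliZ, pauliX] ![0, 0] ![0, 1] = 1
      simp [tensor, pauliX, pauliZ]
    rw [h3] at h1
    have h4 : (z • (1 : Op (Fin 2))) ![0, 0] ![0, 1] = 0 := by
      rw [Matrix.smul_apply, Matrix.one_apply_ne h2, smul_zero]
    exact one_ne_zero (h1.trans h4)
  · intro h
    have h1 : tensor ![pauliX] (fun _ => 0) (fun _ => 1) = 0 :=
      (congrFun (congrFun h fun _ => 0) fun _ => 1).trans hoff
    simp [tensor, pauliX] at h1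
  · intro h
    have h1 : tensor ![pauliZ] (fun _ => 0) (fun _ => 0) = z :=
      (congrFun (congrFun h fun _ => 0) fun _ => 0).trans (hdiag _)
    have h2 : tensor ![pauliZ] (fun _ => 1) (fun _ => 1) = z :=
      (congrFun (congrFun h fun _ => 1) fun _ => 1).trans (hdiag _)
    rw [← h2] at h1
    simp [tensor, pauliZ] at h1
    norm_num at h1
  · intro h
    have h1 : tensor ![matXY] (fun _ => 0) (fun _ => 1) = 0 :=
      (congrFun (congrFun h fun _ => 0) fun _ => 1).trans hoff
    simp [tensor, matXY, pauliX, pauliY] at h1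
    have := congrArg Complex.re h1
    simp at this

/-- A state of zero ancillary qubits is just a scalar. -/
theorem place_none (n : ℕ) (π : Equiv.Perm (Fin n ⊕ Fin 0)) (φ : State (Fin n))
    (χ : State (Fin 0)) : place π φ χ = (χ Fin.elim0) • place π φ (WithLp.toLp 2 fun _ => 1) := by
  ext x
  simp only [place, PiLp.smul_apply, smul_eq_mul, mul_one]
  rw [mul_comm, Subsingleton.elim (fun j => x (π (Sum.inr j))) Fin.elim0]

/-- The gate X on one qubit, with ε = δ = 1, already fails. A bare leaf preserves |0⟩ up to a
scalar, at distance at least 1 from X|0⟩, and a tree with a measurement is excluded by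
non-injectivity. -/
theorem not_approxUniversal_F1_zero : ¬ ApproxUniversal F1 0 := by
  intro h
  obtain ⟨V, hV, hd, p, hp⟩ := h 1 (oneQubit 0 pauliX)
    (oneQubit_mem_unitaryGroup 0 (pauli_mem_unitary (true, false))) 1 one_pos 1 one_pos
  set χ₀ : State (Fin 0) := WithLp.toLp 2 fun _ => 1 with hχ₀
  have hχ₀n : ‖χ₀‖ = 1 := by
    rw [← sq_eq_sq₀ (norm_nonneg _) zero_le_one, EuclideanSpace.norm_sq_eq]
    simp [hχ₀]
  have hplace : ∀ (π : Equiv.Perm (Fin 1 ⊕ Fin 0)) (φ : State (Fin 1)), ‖place π φ χ₀‖ = ‖φ‖ := by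
    intro π φ
    rw [← sq_eq_sq₀ (norm_nonneg _) (norm_nonneg _), norm_sq_place, hχ₀n, one_pow, mul_one]
  let J : Equiv.Perm (Fin 1 ⊕ Fin 0) → State (Fin 1) →ₗ[ℂ] State (Fin 1 ⊕ Fin 0) := fun π =>
    { toFun := fun φ => place π φ χ₀
      map_add' := fun φ φ' => by ext x; simp [place, hχ₀]
      map_smul' := fun z φ => by ext x; simp [place, hχ₀] }
  let J' : State (Fin 1 ⊕ Fin 0) →ₗ[ℂ] State (Fin 1) :=
    { toFun := fun ψ => WithLp.toLp 2 fun y => ψ (Sum.elim y Fin.elim0)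
      map_add' := fun φ φ' => by ext x; simp
      map_smul' := fun z φ => by ext x; simp }
  have hJJ' : ∀ ψ, place 1 (J' ψ) χ₀ = ψ := by
    intro ψ
    ext x
    have hx : Sum.elim (fun i => x (Sum.inl i)) Fin.elim0 = x := by
      funext q
      rcases q with i | i
      · rfl
      · exact i.elim0
    simp [place, J', hχ₀, hx]
  have hJ'n : ∀ ψ, ‖J' ψ‖ = ‖ψ‖ := fun ψ => by rw [← hplace 1 (J' ψ), hJJ']
  cases p with
  | done r =>
    set φ₀ : State (Fin 1) := EuclideanSpace.single (fun _ => 0) 1 with hφ₀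
    have hφ₀n : ‖φ₀‖ = 1 := by simp [hφ₀]
    have hp₀ := hp φ₀ χ₀ hφ₀n hχ₀n
    cases r with
    | none => simp [Protocol.successProb] at hp₀
    | some π =>
      obtain ⟨χ', hχ'⟩ : ∃ χ' : State (Fin 0),
        place 1 φ₀ χ₀ = place π (Matrix.toEuclideanLin V φ₀) χ' := hp₀.2
      -- Constant bit assignments are unaffected by π, so the announced locations play no role.
      have hval : ∀ c : Fin 2, place 1 φ₀ χ₀ (fun _ => c)
          = Matrix.toEuclideanLin V φ₀ (fun _ => c) * χ' (fun _ => c) := fun c => by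
        rw [hχ']
        rfl
      have h01 : ((fun _ => 1) : Fin 1 → Fin 2) ≠ fun _ => 0 := fun h => by
        have := congrFun h 0
        simp at this
      have h0 := hval 0
      have h1 := hval 1
      have e0 : place 1 φ₀ χ₀ (fun _ => 0) = 1 := by simp [place, hφ₀, hχ₀]
      have e1 : place 1 φ₀ χ₀ (fun _ => 1) = 0 := by simp [place, hφ₀, hχ₀, h01]
      have e2 : χ' (fun _ => 1) = χ' (fun _ => 0) :=
        congrArg (fun f : Fin 0 → Fin 2 => χ' f) (Subsingleton.elim _ _)
      rw [e0] at h0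
      rw [e1, e2] at h1
      have hne : χ' (fun _ => 0) ≠ 0 := right_ne_zero_of_mul (h0 ▸ one_ne_zero)
      have hV10 : Matrix.toEuclideanLin V φ₀ (fun _ => 1) = 0 :=
        (mul_eq_zero.mp h1.symm).resolve_right hne
      have hU10 : Matrix.toEuclideanLin (oneQubit 0 pauliX) φ₀ (fun _ : Fin 1 => 1) = 1 := by
        rw [oneQubit_apply]
        have hu : Function.update (fun _ : Fin 1 => (1 : Fin 2)) 0 0 = fun _ => 0 := by
          funext i
          rw [Subsingleton.elim i 0, Function.update_self]
        rw [hu]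
        simp [pauliX, hφ₀]
      have hle := (ContinuousLinearMap.le_opNorm (Matrix.toEuclideanCLM (n := Fin 1 → Fin 2)
        (𝕜 := ℂ) (oneQubit 0 pauliX - V)) φ₀)
      have hent : Matrix.toEuclideanCLM (n := Fin 1 → Fin 2) (𝕜 := ℂ) (oneQubit 0 pauliX - V) φ₀
          (fun _ => 1) = 1 := by
        have : Matrix.toEuclideanCLM (n := Fin 1 → Fin 2) (𝕜 := ℂ) (oneQubit 0 pauliX - V) φ₀
            = Matrix.toEuclideanLin (oneQubit 0 pauliX) φ₀ - Matrix.toEuclideanLin V φ₀ := by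
          rw [← LinearMap.sub_apply, ← map_sub]
          rfl
        rw [this, PiLp.sub_apply, hU10, hV10, sub_zero]
      have hle2 := PiLp.norm_apply_le (Matrix.toEuclideanCLM (n := Fin 1 → Fin 2) (𝕜 := ℂ)
        (oneQubit 0 pauliX - V) φ₀) (fun _ => 1)
      rw [hent, norm_one] at hle2
      rw [hφ₀n, mul_one] at hle
      linarith
  | measure A hA e next =>
    refine not_simulates_measure hA (mat_ne_smul_one hA) e next
      (fun π => J π ∘ₗ Matrix.toEuclideanLin V ∘ₗ J') (fun π => ?_) fun ψ hψ => ?_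
    · refine (injective_iff_map_eq_zero _).mpr fun ψ h0 => ?_
      have h1 : ‖place π (Matrix.toEuclideanLin V (J' ψ)) χ₀‖ = 0 := norm_eq_zero.mpr h0
      rwa [hplace, norm_toEuclideanLin_of_mem_unitaryGroup hV, hJ'n, norm_eq_zero] at h1
    · have h1 := hp (J' ψ) χ₀ ((hJ'n ψ).trans hψ) hχ₀n
      rw [hJJ'] at h1
      refine ⟨fun h0 => ?_, onSuccess_mono ?_ _ _ h1.2⟩
      · rw [h0, sub_self] at h1
        exact lt_irrefl _ h1.1
      · rintro π ψ' ⟨χ', rfl⟩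
        exact ⟨_, place_none _ _ _ _⟩

end NoAncilla

/-! ### Monotonicity in the family, and the strict inclusion -/

section Comparison

variable {Q : Type} [Fintype Q] [DecidableEq Q]

/-- A protocol over a family of observables, as a protocol over a larger family. -/
def Protocol.ofSubset {F F' : Set Observable} (hF : F ⊆ F') : Protocol F Q → Protocol F' Q
  | .done r => .done r
  | .measure A hA e next => .measure A (hF hA) e fun b => (next b).ofSubset hF

theorem successProb_ofSubset {F F' : Set Observable} (hF : F ⊆ F') (p : Protocol F Q) :
    ∀ ψ, (p.ofSubset hF).successProb ψ = p.successProb ψ := by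
  induction p with
  | done r => cases r <;> exact fun _ => rfl
  | measure A hA e next ih =>
    intro ψ
    simp only [Protocol.ofSubset, Protocol.successProb, ih]

theorem onSuccess_ofSubset {F F' : Set Observable} (hF : F ⊆ F')
    (G : Equiv.Perm Q → State Q → Prop) (p : Protocol F Q) :
    ∀ ψ, (p.ofSubset hF).OnSuccess G ψ ↔ p.OnSuccess G ψ := by
  induction p with
  | done r => cases r <;> exact fun _ => Iff.rfl
  | measure A hA e next ih =>
    intro ψ
    simp only [Protocol.ofSubset, Protocol.OnSuccess, ih]

theorem ApproxUniversal.mono {F F' : Set Observable} (hF : F ⊆ F') {k : ℕ}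
    (h : ApproxUniversal F k) : ApproxUniversal F' k := by
  intro n U hU ε hε δ hδ
  obtain ⟨V, hV, hd, p, hp⟩ := h n U hU ε hε δ hδ
  refine ⟨V, hV, hd, p.ofSubset hF, fun φ χ hφ hχ => ?_⟩
  rw [successProb_ofSubset, onSuccess_ofSubset]
  exact hp φ χ hφ hχ

theorem F2_subset_F1 : F2 ⊆ F1 := by
  rintro A (rfl | rfl | rfl) <;> simp [F1]

theorem obsX_notMem_F2 : obsX ∉ F2 := by
  have hent : ∀ {M N : Matrix (Fin 2) (Fin 2) ℂ} {hM hM' hN hN'},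
      Observable.ofTensor ![M] hM hM' = Observable.ofTensor ![N] hN hN' → M = N := by
    intro M N _ _ _ _ h
    injection h with _ h
    ext c d
    have h1 : tensor ![M] = tensor ![N] := h
    have h2 := congrFun (congrFun h1 fun _ => c) fun _ => d
    simpa [tensor] using h2
  rintro (h | h | h)
  · have : (1 : ℕ) = 2 := congrArg Observable.arity h
    omega
  · have := congrFun (congrFun (hent h) 0) 0
    simp [pauliX, pauliZ] at this
  · have := congrArg Complex.im (congrFun (congrFun (hent h) 0) 1)
    -- The off-diagonal entry of (X - Y)/√2 has imaginary part √2/2, whereas that of X is real.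
    simp [matXY, pauliX, pauliY] at this
    exact (by positivity : (0 : ℝ) < Real.sqrt 2 / 2).ne this

theorem F2_ssubset_F1 : F2 ⊂ F1 :=
  (Set.ssubset_iff_of_subset F2_subset_F1).mpr ⟨obsX, by simp [F1], obsX_notMem_F2⟩

end Comparison

end MBQC

/-- The family `F2 = {Z ⊗ X, Z, (X - Y) / √2}` is approximately universal using one ancillary qubit.
Hence there is no trade-off: `F2` is a proper subfamily of `F1 = {Z ⊗ X, X, Z, (X - Y) / √2}`, and
the least number of ancillary qubits is one for both. -/
theorem theorem2 :
    MBQC.ApproxUniversal MBQC.F2 1 ∧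
      (MBQC.F2 ⊂ MBQC.F1 ∧
        IsLeast {k : ℕ | MBQC.ApproxUniversal MBQC.F1 k} 1 ∧
        IsLeast {k : ℕ | MBQC.ApproxUniversal MBQC.F2 k} 1) := by
  have h2 := MBQC.approxUniversal_F2
  have h1 := h2.mono MBQC.F2_subset_F1
  refine ⟨h2, MBQC.F2_ssubset_F1, ⟨h1, fun k hk => ?_⟩, ⟨h2, fun k hk => ?_⟩⟩
  · refine Nat.one_le_iff_ne_zero.mpr ?_
    rintro rfl
    exact MBQC.not_approxUniversal_F1_zero hk
  · refine Nat.one_le_iff_ne_zero.mpr ?_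
    rintro rfl
    exact MBQC.not_approxUniversal_F1_zero (MBQC.ApproxUniversal.mono MBQC.F2_subset_F1 hk)
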